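/- Let $k$ be an algebraically closed field of characteristic $0$, and let $S=k[x_1,x_2,x_3,x_4]$ act on $R=k[y_1,y_2,y_3,y_4]$ by partial derivation, $x_i$ acting as $\partial/\partial y_i$. Let $g\in R$ be a cubic form, let $g^\perp=\{f\in S : f(g)=0\}$, and suppose that the graded algebra $A=S/g^\perp$ has Hilbert function $(1,4,4,1)$, i.e. $\dim_k A_0=\dim_k A_3=1$, $\dim_k A_1=\dim_k A_2=4$ and $A_i=0$ for $i\ge 4$. Then there is an integer $\beta\ge 0$ such that the minimal graded free resolution of $A$ over $S$ exists and has the form $$0\to S(-7)\to S(-5)^{6}\oplus S(-4)^{\beta}\to S(-4)^{5+\beta}\oplus S(-3)^{5+\beta}\to S(-3)^{\beta}\oplus S(-2)^{6}\to S\to A\to 0,$$ that is, a minimal graded free resolution of $A$ by finitely generated free modules exists, and every such resolution has this form with this same $\beta$. In particular $g^\perp$ has no minimal homogeneous generators of degree $\ge 4$: every form $f\in g^\perp$ of degree $\ge 4$ lies in $(x_1,x_2,x_3,x_4)\,g^\perp$. -/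

import Mathlib

open MvPolynomial

noncomputable section

namespace Apolarity

/-! ### The apolarity action and the ideal `g^⊥` -/

section Action

variable {σ k : Type*} [Field k]

lemma pderiv_commute (i j : σ) :
    Commute (pderiv i : Derivation k (MvPolynomial σ k) (MvPolynomial σ k)).toLinearMap
      (pderiv j : Derivation k (MvPolynomial σ k) (MvPolynomial σ k)).toLinearMap := by
  classical
  refine LinearMap.ext fun f => MvPolynomial.ext _ _ fun m => ?_
  change coeff m (pderiv i (pderiv j f)) = coeff m (pderiv j (pderiv i f))
  rcases eq_or_ne i j with rfl | h
  · rfl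
  · simp only [coeff_pderiv, add_right_comm m, Finsupp.add_apply,
      Finsupp.single_eq_of_ne h, Finsupp.single_eq_of_ne h.symm, add_zero]
    ring

lemma pairwise_commute (α : σ → ℕ) (s : Set σ) :
    s.Pairwise (Function.onFun Commute fun i =>
      (pderiv i : Derivation k (MvPolynomial σ k) (MvPolynomial σ k)).toLinearMap ^ α i) :=
  fun i _ j _ _ => (pderiv_commute i j).pow_pow _ _

variable [Fintype σ]

variable (σ k) in
/-- The multiplicative map sending the exponent `α` to the differential operator
`∏ i, (∂/∂y_i) ^ (α i)`. -/
def partialMonoidHom :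
    Multiplicative (σ →₀ ℕ) →* Module.End k (MvPolynomial σ k) where
  toFun α := Finset.univ.noncommProd
    (fun i => (pderiv i : Derivation k (MvPolynomial σ k) (MvPolynomial σ k)).toLinearMap ^
      (Multiplicative.toAdd α i))
    (pairwise_commute _ _)
  map_one' := by
    refine (Finset.noncommProd_eq_pow_card _ _ _ 1 fun i _ => ?_).trans (one_pow _)
    simp
  map_mul' α β := by
    refine Eq.trans ?_ (Finset.noncommProd_mul_distrib _ _ (pairwise_commute _ _)
      (pairwise_commute _ _) fun i _ j _ _ => (pderiv_commute i j).pow_pow _ _)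
    refine Finset.noncommProd_congr rfl (fun i _ => ?_) _
    simp [pow_add]

variable (σ k) in
/-- The action of `S = k[x_i]` on `R = k[y_i]` by partial derivation, `x_i` acting as
`∂/∂y_i`: the algebra homomorphism `S → End_k R` with `x^α ↦ ∏ i, (∂/∂y_i) ^ (α i)`. -/
def action : MvPolynomial σ k →ₐ[k] Module.End k (MvPolynomial σ k) :=
  AddMonoidAlgebra.lift k (Module.End k (MvPolynomial σ k)) (σ →₀ ℕ) (partialMonoidHom σ k)

variable (k) in
lemma action_X (i : σ) : action σ k (X i) =
    (pderiv i : Derivation k (MvPolynomial σ k) (MvPolynomial σ k)).toLinearMap := by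
  classical
  have h : (X i : MvPolynomial σ k) =
    AddMonoidAlgebra.single (Finsupp.single i 1) (1 : k) := rfl
  rw [h, action, AddMonoidAlgebra.lift_single, one_smul]
  change Finset.noncommProd _ _ (pairwise_commute (Finsupp.single i 1) _) = _
  refine (Finset.mul_noncommProd_erase _ (Finset.mem_univ i) _ _).symm.trans ?_
  refine (congrArg _ (Finset.noncommProd_eq_pow_card _ _ _ 1 fun j hj => ?_)).trans ?_
  · rw [toAdd_ofAdd, Finsupp.single_eq_of_ne (Finset.ne_of_mem_erase hj), pow_zero]
  · rw [toAdd_ofAdd, Finsupp.single_eq_same, pow_one, one_pow, mul_one]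

/-- The apolar ideal `g^⊥ = {f ∈ S ∣ f(g) = 0}`. -/
def perp (g : MvPolynomial σ k) : Ideal (MvPolynomial σ k) where
  carrier := {f | action σ k f g = 0}
  zero_mem' := by simp
  add_mem' {a b} ha hb := by
    simp only [Set.mem_ofPred_eq] at ha hb ⊢
    simp [ha, hb]
  smul_mem' c f hf := by
    simp only [Set.mem_ofPred_eq] at hf ⊢
    simp [hf]

end Action

/-! ### Graded quotients of a polynomial ring and their graded free resolutions -/

section Resolutions

variable {σ k : Type*} [Field k]

/-- The Hilbert function `i ↦ dim_k A_i` of `A = S/I`, where `A_i` is the image in `A` of the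
space of forms of degree `i` (`I` is meant to be a homogeneous ideal). -/
def hilbertFunction (I : Ideal (MvPolynomial σ k)) (i : ℕ) : ℕ :=
  Module.finrank k
    ((homogeneousSubmodule σ k i).map (Ideal.Quotient.mkₐ k I).toLinearMap)

/-- `f ∈ S_m`, for an integer `m`, where `S_m = 0` for `m < 0`. -/
def IsOfDegree (f : MvPolynomial σ k) (m : ℤ) : Prop :=
  ∀ γ : σ →₀ ℕ, coeff γ f ≠ 0 → (γ.degree : ℤ) = m

/-- A graded free resolution of the graded `S`-module `S/I` by finitely generated graded free
modules and degree-preserving maps,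
`⋯ ⟶ F 2 ⟶ F 1 ⟶ F 0 ⟶ S/I ⟶ 0`, with `F i = ⨁ a, S(-(deg i a))`: the `a`-th basis vector of
`F i` is homogeneous of degree `deg i a`. -/
structure GradedFreeResolution (I : Ideal (MvPolynomial σ k)) where
  /-- the rank of `F i` -/
  rank : ℕ → ℕ
  /-- the degrees of the basis vectors of `F i` -/
  deg : ∀ i, Fin (rank i) → ℤ
  /-- the differential `F (i + 1) ⟶ F i` -/
  d : ∀ i, (Fin (rank (i + 1)) → MvPolynomial σ k) →ₗ[MvPolynomial σ k]
    (Fin (rank i) → MvPolynomial σ k)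
  /-- the augmentation `F 0 ⟶ S/I` -/
  aug : (Fin (rank 0) → MvPolynomial σ k) →ₗ[MvPolynomial σ k] (MvPolynomial σ k ⧸ I)
  d_degree : ∀ i b a, IsOfDegree (d i (Pi.single b 1) a) (deg (i + 1) b - deg i a)
  aug_degree : ∀ a, ∃ f : MvPolynomial σ k, IsOfDegree f (deg 0 a) ∧
    aug (Pi.single a 1) = Ideal.Quotient.mk I f
  aug_surjective : Function.Surjective aug
  exact_aug : Function.Exact (d 0) aug
  exact_d : ∀ i, Function.Exact (d (i + 1)) (d i)

namespace GradedFreeResolution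

variable {I : Ideal (MvPolynomial σ k)}

/-- The resolution is minimal: the image of each differential lies in `(x_1, …, x_n) F i`. -/
def IsMinimal (F : GradedFreeResolution I) : Prop :=
  ∀ i v a, F.d i v a ∈ idealOfVars σ k

/-- The multiset of the degrees of the basis vectors of `F i`; it determines `F i` as a graded
module: `F i` is the direct sum of the modules `S(-j)`, `j` running over this multiset. -/
def twists (F : GradedFreeResolution I) (i : ℕ) : Multiset ℤ :=
  (Finset.univ : Finset (Fin (F.rank i))).val.map (F.deg i)

/-- The resolution has the form
`0 → S(-7) → S(-5)^6 ⊕ S(-4)^β → S(-4)^(5+β) ⊕ S(-3)^(5+β) → S(-3)^β ⊕ S(-2)^6 → S`. -/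
def HasShape (F : GradedFreeResolution I) (β : ℕ) : Prop :=
  F.twists 0 = {0} ∧
  F.twists 1 = Multiset.replicate β 3 + Multiset.replicate 6 2 ∧
  F.twists 2 = Multiset.replicate (5 + β) 4 + Multiset.replicate (5 + β) 3 ∧
  F.twists 3 = Multiset.replicate 6 5 + Multiset.replicate β 4 ∧
  F.twists 4 = {7} ∧
  ∀ i, 5 ≤ i → F.twists i = 0

end GradedFreeResolution

end Resolutions

end Apolarity

end

noncomputable section

namespace Apolarity

/-! ### The Koszul complex of a module over a polynomial ring -/

/-! The multiplicity of S(-j) in the i-th module of a minimal graded resolution of A = S/g^⊥ is dim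
Tor_i(A, k)_j, computed as homology of the Koszul complex with pieces K_{p,j} = ⋀^p k^4 ⊗ A_{j-p}.
Hence it depends on A alone (`card_deg_eq_koszulBetti`), and the theorem becomes a count of ranks of
Koszul differentials. The comparison is dimension shifting along the resolution
(`koszulBetti_map_eq_ker`); it needs the Koszul complex of a free module to be acyclic away from the
generators, for which the de Rham differential is a homotopy in characteristic 0
(`koszul_deRham_add`).

Let R(p, j) be the rank of K_{p+1,j} → K_{p,j}. Three facts control it. No linear form kills g, so
the differential is injective on ⋀^{p+1} ⊗ A_0 (`finrank_koszulBoundaries_linear`). A is generated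
by 1, so R(0, j) = dim A_j for j ≠ 0 (`finrank_koszulBoundaries_quotPart_zero`). A is Gorenstein: f
↦ f(g)(0) pairs A_i perfectly with A_{3-i}, the Koszul differential is self-adjoint for the induced
pairing, and R(p, j) = R(3-p, 7-j) (`finrank_koszulBoundaries_symm`). For the Hilbert function
(1,4,4,1) this leaves a single unknown R(1, 3) = R(2, 4), and β = 15 - R(1, 3) (`koszulBetti_perp`).

Generators of degree ≥ 4 are excluded because Tor_1 vanishes there and, in positive degrees,
Tor_1(S/I, k) = I/𝔪I. Minimal resolutions exist by iterating covers with the least number of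
homogeneous generators (`exists_minimal_cover`). -/

section Sign

variable {n : ℕ}

/-- The sign with which `e_b` is moved past the elements of `T` that precede `b`. -/
def koszulSign (b : Fin n) (T : Finset (Fin n)) : ℤ := ∏ c ∈ T, if c < b then -1 else 1

lemma koszulSign_mul_self (b : Fin n) (T : Finset (Fin n)) :
    koszulSign b T * koszulSign b T = 1 := by
  rw [koszulSign, ← Finset.prod_mul_distrib]
  exact Finset.prod_eq_one fun c _ => by split_ifs <;> rfl

lemma koszulSign_insert {b c : Fin n} {T : Finset (Fin n)} (h : c ∉ T) :
    koszulSign b (insert c T) = (if c < b then -1 else 1) * koszulSign b T :=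
  Finset.prod_insert h

/-- Exactly one of b < c and c < b holds, so exactly one of the two insertions costs a sign. This is
what makes the differential square to zero. -/
lemma koszulSign_swap {b c : Fin n} {T : Finset (Fin n)} (hbc : b ≠ c) (hb : b ∉ T) (hc : c ∉ T) :
    koszulSign b T * koszulSign c (insert b T) = -(koszulSign c T * koszulSign b (insert c T)) := by
  rw [koszulSign_insert hb, koszulSign_insert hc]
  rcases lt_or_gt_of_ne hbc with h | h <;> simp [h, h.not_gt] <;> ring

/-- Same reason; this form says that contraction with b anticommutes with exterior multiplication by
c ≠ b. -/
lemma koszulSign_mixed {b c : Fin n} {T : Finset (Fin n)} (hbc : b ≠ c) (hb : b ∉ T) (hc : c ∉ T) :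
    koszulSign b (insert c T) * koszulSign c (insert b T) = -(koszulSign c T * koszulSign b T) := by
  rw [koszulSign_insert hb, koszulSign_insert hc]
  rcases lt_or_gt_of_ne hbc with h | h <;> simp [h, h.not_gt] <;> ring

end Sign

/-! ### Koszul chains of given homological and internal degree -/

section GradedPieces

variable {n : ℕ} {k : Type*} [Field k] {M : Type*} [AddCommGroup M] [Module k M]

/-- The part of the Koszul complex in homological degree `p` and internal degree `j`; `𝓜` is the
family of the graded pieces of `M`. -/
def koszulPart (𝓜 : ℤ → Submodule k M) (p : ℕ) (j : ℤ) : Submodule k (Finset (Fin n) → M) where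
  carrier := {ω | ∀ T : Finset (Fin n), (T.card = p → ω T ∈ 𝓜 (j - p)) ∧ (T.card ≠ p → ω T = 0)}
  zero_mem' T := by simp
  add_mem' {ω η} h h' T := ⟨fun hT => add_mem ((h T).1 hT) ((h' T).1 hT), fun hT => by
    rw [Pi.add_apply, (h T).2 hT, (h' T).2 hT, add_zero]⟩
  smul_mem' r ω h T := ⟨fun hT => Submodule.smul_mem _ r ((h T).1 hT), fun hT => by
    rw [Pi.smul_apply, (h T).2 hT, smul_zero]⟩

lemma koszulPart_mono {𝓜 𝓜' : ℤ → Submodule k M} {p : ℕ} {j : ℤ} (h : ∀ i, 𝓜 i ≤ 𝓜' i) :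
    koszulPart (n := n) 𝓜 p j ≤ koszulPart 𝓜' p j :=
  fun _ hω T => ⟨fun hT => h _ ((hω T).1 hT), (hω T).2⟩

lemma koszulPart_of_lt (𝓜 : ℤ → Submodule k M) {p : ℕ} (hp : n < p) (j : ℤ) :
    koszulPart (n := n) 𝓜 p j = ⊥ := by
  refine (Submodule.eq_bot_iff _).2 fun ω hω => funext fun T => (hω T).2 ?_
  have := T.card_le_univ
  simp at this
  omega

lemma koszulPart_inf_ker {L : Type*} [AddCommGroup L] [Module k L]
    (𝓜 : ℤ → Submodule k M) (g : M →ₗ[k] L) (p : ℕ) (j : ℤ) (ω : Finset (Fin n) → M) :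
    ω ∈ koszulPart (fun i => 𝓜 i ⊓ LinearMap.ker g) p j ↔
      ω ∈ koszulPart 𝓜 p j ∧ ∀ T, g (ω T) = 0 := by
  constructor
  · refine fun h => ⟨koszulPart_mono (fun _ => inf_le_left) h, fun T => ?_⟩
    by_cases hT : T.card = p
    · exact ((h T).1 hT).2
    · rw [(h T).2 hT, map_zero]
  · exact fun h T => ⟨fun hT => ⟨(h.1 T).1 hT, h.2 T⟩, (h.1 T).2⟩

lemma exists_koszulPart_lift {L : Type*} [AddCommGroup L] [Module k L]
    (𝓜 : ℤ → Submodule k M) (g : M →ₗ[k] L) (p : ℕ) (j : ℤ) {ω : Finset (Fin n) → L}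
    (hω : ω ∈ koszulPart (fun i => (𝓜 i).map g) p j) :
    ∃ η ∈ koszulPart 𝓜 p j, (fun T => g (η T)) = ω := by
  have : ∀ T, ∃ m, (T.card = p → m ∈ 𝓜 (j - p)) ∧ (T.card ≠ p → m = 0) ∧ g m = ω T := by
    intro T
    by_cases hT : T.card = p
    · obtain ⟨m, hm, h⟩ := (hω T).1 hT
      exact ⟨m, fun _ => hm, fun h => absurd hT h, h⟩
    · exact ⟨0, fun h => absurd h hT, fun _ => rfl, by rw [(hω T).2 hT, map_zero]⟩
  choose η h1 h2 h3 using this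
  exact ⟨η, fun T => ⟨h1 T, h2 T⟩, funext h3⟩

lemma map_mem_koszulPart {L : Type*} [AddCommGroup L] [Module k L]
    {𝓜 : ℤ → Submodule k M} (g : M →ₗ[k] L) {p : ℕ} {j : ℤ} {ω : Finset (Fin n) → M}
    (hω : ω ∈ koszulPart 𝓜 p j) :
    (fun T => g (ω T)) ∈ koszulPart (fun i => (𝓜 i).map g) p j :=
  fun T => ⟨fun hT => Submodule.mem_map_of_mem ((hω T).1 hT), fun hT => by
    simp only [(hω T).2 hT, map_zero]⟩

end GradedPieces

/-! ### The Koszul differential and dimension shifting -/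

section Koszul

variable {n : ℕ} (k : Type*) [Field k] {M N : Type*}
  [AddCommGroup M] [Module (MvPolynomial (Fin n) k) M] [Module k M]
  [IsScalarTower k (MvPolynomial (Fin n) k) M]
  [AddCommGroup N] [Module (MvPolynomial (Fin n) k) N] [Module k N]
  [IsScalarTower k (MvPolynomial (Fin n) k) N]

/-- The Koszul differential; an element `ω` of `⋀ S^n ⊗ M` is given by its coefficients `ω T` at
the basis elements `e_T`. -/
def koszul : (Finset (Fin n) → M) →ₗ[k] (Finset (Fin n) → M) where
  toFun ω T := ∑ b, if b ∈ T then 0 else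
    koszulSign b T • (X b : MvPolynomial (Fin n) k) • ω (insert b T)
  map_add' ω η := by
    ext T
    simp only [Pi.add_apply, ← Finset.sum_add_distrib]
    refine Finset.sum_congr rfl fun b _ => ?_
    split_ifs <;> simp
  map_smul' r ω := by
    ext T
    simp only [Pi.smul_apply, RingHom.id_apply, Finset.smul_sum]
    refine Finset.sum_congr rfl fun b _ => ?_
    split_ifs
    · simp
    · rw [smul_comm r (koszulSign b T), smul_algebra_smul_comm r]

variable {k}

lemma koszul_apply (ω : Finset (Fin n) → M) (T : Finset (Fin n)) :
    koszul k ω T = ∑ b, if b ∈ T then 0 else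
      koszulSign b T • (X b : MvPolynomial (Fin n) k) • ω (insert b T) := rfl

lemma koszul_map (f : M →ₗ[MvPolynomial (Fin n) k] N) (ω : Finset (Fin n) → M) :
    koszul k (fun T => f (ω T)) = fun T => f (koszul k ω T) := by
  ext T
  simp only [koszul_apply, map_sum]
  refine Finset.sum_congr rfl fun b _ => ?_
  split_ifs <;> simp

/-- The double sum over b and c is antisymmetric, hence equal to its own negative; characteristic 0
removes the factor 2. -/
lemma koszul_koszul [CharZero k] (ω : Finset (Fin n) → M) : koszul k (koszul k ω) = 0 := by
  ext T
  set t : Fin n → Fin n → M := fun b c => if b ∈ T ∨ c ∈ T ∨ b = c then 0 else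
    (koszulSign b T * koszulSign c (insert b T)) •
      (X b * X c : MvPolynomial (Fin n) k) • ω (insert b (insert c T)) with ht
  have h1 : koszul k (koszul k ω) T = ∑ b, ∑ c, t b c := by
    rw [koszul_apply]
    refine Finset.sum_congr rfl fun b _ => ?_
    split_ifs with hb
    · simp [ht, hb]
    · rw [koszul_apply, Finset.smul_sum, Finset.smul_sum]
      refine Finset.sum_congr rfl fun c _ => ?_
      by_cases hc : c ∈ T
      · simp [ht, hc]
      by_cases hbc : b = c
      · simp [ht, hbc]
      · have : ¬ (c ∈ insert b T) := by simp [hc, Ne.symm hbc]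
        rw [if_neg this]
        simp only [ht, hb, hc, hbc, or_self, if_false]
        rw [smul_comm (X b : MvPolynomial (Fin n) k) (koszulSign c _), smul_smul, smul_smul,
          Finset.insert_comm]
  have h2 : ∀ b c, t b c = - t c b := by
    intro b c
    by_cases h : b ∈ T ∨ c ∈ T ∨ b = c
    · have h' : c ∈ T ∨ b ∈ T ∨ c = b := by tauto
      simp only [ht]
      rw [if_pos h, if_pos h', neg_zero]
    · have h' : ¬ (c ∈ T ∨ b ∈ T ∨ c = b) := by tauto
      simp only [ht]
      rw [if_neg h, if_neg h']
      push Not at h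
      rw [koszulSign_swap h.2.2 h.1 h.2.1, neg_smul, mul_comm (X b : MvPolynomial (Fin n) k),
        Finset.insert_comm]
  have h3 : ∑ b, ∑ c, t b c = - ∑ b, ∑ c, t b c := by
    conv_rhs => rw [Finset.sum_comm]
    rw [← Finset.sum_neg_distrib]
    refine Finset.sum_congr rfl fun b _ => ?_
    rw [← Finset.sum_neg_distrib]
    exact Finset.sum_congr rfl fun c _ => h2 b c
  have h4 : (2 : k) • ∑ b, ∑ c, t b c = 0 := by
    rw [two_smul]
    nth_rewrite 1 [h3]
    exact neg_add_cancel _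
  rw [h1]
  exact (smul_eq_zero.1 h4).resolve_left two_ne_zero

/-- Multiplication by the variables raises the degree by one. -/
def IsGradedFamily (n : ℕ) [Module (MvPolynomial (Fin n) k) M] (𝓜 : ℤ → Submodule k M) : Prop :=
  ∀ (b : Fin n) (j : ℤ), ∀ m ∈ 𝓜 j, (X b : MvPolynomial (Fin n) k) • m ∈ 𝓜 (j + 1)

lemma IsGradedFamily.koszul_mem {𝓜 : ℤ → Submodule k M} (h𝓜 : IsGradedFamily n 𝓜) {p : ℕ} {j : ℤ}
    {ω : Finset (Fin n) → M} (hω : ω ∈ koszulPart 𝓜 (p + 1) j) :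
    koszul k ω ∈ koszulPart 𝓜 p j := by
  intro T
  rw [koszul_apply]
  constructor
  · intro hT
    refine Submodule.sum_mem _ fun b _ => ?_
    split_ifs with hb
    · exact zero_mem _
    · refine zsmul_mem ?_ _
      have := h𝓜 b _ _ ((hω (insert b T)).1 (by rw [Finset.card_insert_of_notMem hb, hT]))
      convert this using 2
      push_cast
      ring
  · intro hT
    refine Finset.sum_eq_zero fun b _ => ?_
    split_ifs with hb
    · rfl
    · rw [(hω (insert b T)).2 (by rw [Finset.card_insert_of_notMem hb]; omega), smul_zero,
        smul_zero]

lemma koszul_eq_zero_of_mem_zero {𝓜 : ℤ → Submodule k M} {j : ℤ}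
    {ω : Finset (Fin n) → M} (hω : ω ∈ koszulPart 𝓜 0 j) : koszul k ω = 0 := by
  ext T
  rw [koszul_apply]
  refine Finset.sum_eq_zero fun b _ => ?_
  split_ifs with hb
  · rfl
  · rw [(hω (insert b T)).2 (by rw [Finset.card_insert_of_notMem hb]; omega), smul_zero,
      smul_zero]

/-- The cycles of the Koszul complex. -/
def koszulCycles (𝓜 : ℤ → Submodule k M) (p : ℕ) (j : ℤ) : Submodule k (Finset (Fin n) → M) :=
  koszulPart 𝓜 p j ⊓ LinearMap.ker (koszul k)

/-- The boundaries of the Koszul complex. -/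
def koszulBoundaries (𝓜 : ℤ → Submodule k M) (p : ℕ) (j : ℤ) :
    Submodule k (Finset (Fin n) → M) :=
  (koszulPart 𝓜 (p + 1) j).map (koszul k)

/-- The dimension of the Koszul homology in homological degree `p` and internal degree `j`. -/
def koszulBetti (n : ℕ) [Module (MvPolynomial (Fin n) k) M]
    [IsScalarTower k (MvPolynomial (Fin n) k) M] (𝓜 : ℤ → Submodule k M) (p : ℕ) (j : ℤ) : ℕ :=
  Module.finrank k (koszulCycles (n := n) 𝓜 p j ⧸
    (koszulBoundaries 𝓜 p j).submoduleOf (koszulCycles 𝓜 p j))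

/-- Two surjections from the same space with the same kernel have isomorphic targets. -/
lemma finrank_quotient_eq_of_surjective {V U W : Type*} [AddCommGroup V] [Module k V]
    [AddCommGroup U] [Module k U] [AddCommGroup W] [Module k W] (f : V →ₗ[k] U) (g : V →ₗ[k] W)
    (P : Submodule k U) (Q : Submodule k W)
    (hf : Function.Surjective f) (hg : Function.Surjective g)
    (h : ∀ v, f v ∈ P ↔ g v ∈ Q) :
    Module.finrank k (U ⧸ P) = Module.finrank k (W ⧸ Q) := by
  have hf' : Function.Surjective (P.mkQ ∘ₗ f) := P.mkQ_surjective.comp hf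
  have hg' : Function.Surjective (Q.mkQ ∘ₗ g) := Q.mkQ_surjective.comp hg
  have hk : LinearMap.ker (P.mkQ ∘ₗ f) = LinearMap.ker (Q.mkQ ∘ₗ g) := by
    ext v
    simpa using h v
  exact LinearEquiv.finrank_eq
    (((P.mkQ ∘ₗ f).quotKerEquivOfSurjective hf').symm ≪≫ₗ
    Submodule.quotEquivOfEq _ _ hk ≪≫ₗ (Q.mkQ ∘ₗ g).quotKerEquivOfSurjective hg')

/-- The Koszul homology of a module `g(F)` is that of `ker g`, shifted, when `F` is Koszul-acyclic
in the relevant degrees. -/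
lemma koszulBetti_map_eq_ker [CharZero k] {𝓜 : ℤ → Submodule k M}
    (h𝓜 : IsGradedFamily n 𝓜) (g : M →ₗ[MvPolynomial (Fin n) k] N) (p : ℕ) (j : ℤ)
    (hex : koszulCycles (n := n) 𝓜 (p + 1) j ≤ koszulBoundaries 𝓜 (p + 1) j)
    (hex' : koszulCycles (n := n) (fun i => 𝓜 i ⊓ LinearMap.ker (g.restrictScalars k)) p j ≤
      koszulBoundaries 𝓜 p j) :
    koszulBetti n (fun i => (𝓜 i).map (g.restrictScalars k)) (p + 1) j =
      koszulBetti n (fun i => 𝓜 i ⊓ LinearMap.ker (g.restrictScalars k)) p j := by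
  set g' := g.restrictScalars k with hg'
  have hgk : ∀ ω : Finset (Fin n) → M, koszul k (fun T => g' (ω T)) = fun T => g' (koszul k ω T) :=
    fun ω => koszul_map g ω
  -- V consists of the chains of F that become cycles in g(F). Both g (as `f₁`) and the differential
  -- (as `f₂`) map it onto cycles, and passing from one to the other is the connecting homomorphism.
  set V : Submodule k (Finset (Fin n) → M) :=
    koszulPart 𝓜 (p + 1) j ⊓ LinearMap.ker ((g'.compLeft _) ∘ₗ koszul k) with hV
  have hVmem : ∀ ω : Finset (Fin n) → M, ω ∈ V ↔ ω ∈ koszulPart 𝓜 (p + 1) j ∧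
      ∀ T, g' (koszul k ω T) = 0 := by
    intro ω
    simp only [hV, Submodule.mem_inf, LinearMap.mem_ker, LinearMap.comp_apply, funext_iff]
    rfl
  let f₁ : V →ₗ[k] koszulCycles (n := n) (fun i => (𝓜 i).map g') (p + 1) j :=
    ((g'.compLeft (Finset (Fin n))) ∘ₗ V.subtype).codRestrict _ (by
      rintro ⟨ω, hω⟩
      obtain ⟨h1, h2⟩ := (hVmem ω).1 hω
      refine ⟨map_mem_koszulPart g' h1, ?_⟩
      change koszul k (fun T => g' (ω T)) = 0
      rw [hgk]
      exact funext h2)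
  let f₂ : V →ₗ[k] koszulCycles (n := n) (fun i => 𝓜 i ⊓ LinearMap.ker g') p j :=
    (koszul k ∘ₗ V.subtype).codRestrict _ (by
      rintro ⟨ω, hω⟩
      obtain ⟨h1, h2⟩ := (hVmem ω).1 hω
      exact ⟨(koszulPart_inf_ker _ _ _ _ _).2 ⟨h𝓜.koszul_mem h1, h2⟩, koszul_koszul ω⟩)
  refine finrank_quotient_eq_of_surjective f₁ f₂ _ _ ?_ ?_ ?_
  · rintro ⟨ω, hω, hω'⟩
    obtain ⟨η, hη, rfl⟩ := exists_koszulPart_lift _ _ _ _ hω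
    refine ⟨⟨η, (hVmem η).2 ⟨hη, fun T => ?_⟩⟩, ?_⟩
    · have h : koszul k (fun T => g' (η T)) = 0 := hω'
      rw [hgk] at h
      exact congrFun h T
    · rfl
  · rintro ⟨ζ, hζ⟩
    obtain ⟨ω, hω, rfl⟩ := hex' hζ
    refine ⟨⟨ω, (hVmem ω).2 ⟨hω, ((koszulPart_inf_ker _ _ _ _ _).1 hζ.1).2⟩⟩, ?_⟩
    rfl
  · rintro ⟨ω, hω⟩
    obtain ⟨h1, h2⟩ := (hVmem ω).1 hω
    change (fun T => g' (ω T)) ∈ koszulBoundaries _ _ _ ↔ koszul k ω ∈ koszulBoundaries _ _ _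
    constructor
    -- If g ω is the boundary of g η, then ω - ∂η lies in ker g and has the same boundary as ω.
    · rintro ⟨θ, hθ, hθω⟩
      obtain ⟨η, hη, rfl⟩ := exists_koszulPart_lift _ _ _ _ hθ
      rw [hgk] at hθω
      refine ⟨ω - koszul k η, (koszulPart_inf_ker _ _ _ _ _).2
        ⟨sub_mem h1 (h𝓜.koszul_mem hη), fun T => ?_⟩, ?_⟩
      · rw [Pi.sub_apply, map_sub, sub_eq_zero]
        exact (congrFun hθω T).symm
      · rw [map_sub, koszul_koszul, sub_zero]
    -- If ∂ω = ∂η with η in ker g, then ω - η is a cycle of F, hence some ∂θ by acyclicity, and g ω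
    -- = ∂(g θ).
    · rintro ⟨η, hη, hηω⟩
      obtain ⟨hη1, hη2⟩ := (koszulPart_inf_ker _ _ _ _ _).1 hη
      obtain ⟨θ, hθ, hθ'⟩ := hex ⟨sub_mem h1 hη1, LinearMap.mem_ker.2 (by
        rw [map_sub, hηω, sub_self])⟩
      refine ⟨fun T => g' (θ T), map_mem_koszulPart g' hθ, ?_⟩
      rw [hgk, hθ']
      ext T
      rw [Pi.sub_apply, map_sub, hη2, sub_zero]

/-- If `ker g` lies in the irrelevant ideal times `F`, then `F` and `g(F)` have the same minimal
number of generators in each degree. -/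
lemma koszulBetti_map_zero {𝓜 : ℤ → Submodule k M}
    (h𝓜 : IsGradedFamily n 𝓜) (g : M →ₗ[MvPolynomial (Fin n) k] N) (j : ℤ)
    (hex : koszulPart (n := n) (fun i => 𝓜 i ⊓ LinearMap.ker (g.restrictScalars k)) 0 j ≤
      koszulBoundaries 𝓜 0 j) :
    koszulBetti n (fun i => (𝓜 i).map (g.restrictScalars k)) 0 j = koszulBetti n 𝓜 0 j := by
  set g' := g.restrictScalars k with hg'
  have hgk : ∀ ω : Finset (Fin n) → M, koszul k (fun T => g' (ω T)) = fun T => g' (koszul k ω T) :=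
    fun ω => koszul_map g ω
  let f₁ : koszulPart (n := n) 𝓜 0 j →ₗ[k] koszulCycles (n := n) (fun i => (𝓜 i).map g') 0 j :=
    ((g'.compLeft (Finset (Fin n))) ∘ₗ Submodule.subtype _).codRestrict _ (by
      rintro ⟨ω, hω⟩
      exact ⟨map_mem_koszulPart g' hω, koszul_eq_zero_of_mem_zero (map_mem_koszulPart g' hω)⟩)
  let f₂ : koszulPart (n := n) 𝓜 0 j →ₗ[k] koszulCycles (n := n) 𝓜 0 j :=
    (Submodule.subtype _).codRestrict _ (by
      rintro ⟨ω, hω⟩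
      exact ⟨hω, koszul_eq_zero_of_mem_zero hω⟩)
  refine finrank_quotient_eq_of_surjective f₁ f₂ _ _ ?_ ?_ ?_
  · rintro ⟨ω, hω, hω'⟩
    obtain ⟨η, hη, rfl⟩ := exists_koszulPart_lift _ _ _ _ hω
    refine ⟨⟨η, hη⟩, ?_⟩
    rfl
  · rintro ⟨ω, hω⟩
    refine ⟨⟨ω, hω.1⟩, ?_⟩
    rfl
  · rintro ⟨ω, hω⟩
    change (fun T => g' (ω T)) ∈ koszulBoundaries _ _ _ ↔ ω ∈ koszulBoundaries _ _ _
    constructor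
    · rintro ⟨θ, hθ, hθω⟩
      obtain ⟨η, hη, rfl⟩ := exists_koszulPart_lift _ _ _ _ hθ
      rw [hgk] at hθω
      have h1 : koszul k η ∈ koszulPart 𝓜 0 j := h𝓜.koszul_mem hη
      have h2 : ω - koszul k η ∈ koszulBoundaries 𝓜 0 j := hex
        ((koszulPart_inf_ker _ _ _ _ _).2 ⟨sub_mem hω h1, fun T => by
          rw [Pi.sub_apply, map_sub, sub_eq_zero]
          exact (congrFun hθω T).symm⟩)
      have h3 := add_mem h2 (Submodule.mem_map_of_mem hη : koszul k η ∈ koszulBoundaries 𝓜 0 j)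
      rwa [sub_add_cancel] at h3
    · rintro ⟨θ, hθ, rfl⟩
      exact ⟨fun T => g' (θ T), map_mem_koszulPart g' hθ, hgk θ⟩

end Koszul

/-! ### Forms of integral degree -/

section Forms

variable {n : ℕ} {k : Type*} [Field k]

variable (n k) in
/-- The space of forms of degree `m`, for an integer `m`. -/
def formPart (m : ℤ) : Submodule k (MvPolynomial (Fin n) k) where
  carrier := {f | IsOfDegree f m}
  zero_mem' γ h := absurd (coeff_zero γ) h
  add_mem' {f g} hf hg γ h := by
    by_cases hfγ : coeff γ f = 0
    · exact hg γ fun h' => h (by rw [coeff_add, hfγ, h', add_zero])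
    · exact hf γ hfγ
  smul_mem' r f hf γ h := hf γ fun h' => h (by rw [coeff_smul, h', smul_zero])

lemma mem_formPart {f : MvPolynomial (Fin n) k} {m : ℤ} : f ∈ formPart n k m ↔ IsOfDegree f m :=
  Iff.rfl

lemma weight_one_eq_degree (γ : Fin n →₀ ℕ) : Finsupp.weight 1 γ = γ.degree := by
  rw [Finsupp.degree_eq_weight_one]
  rfl

lemma mem_formPart_natCast {f : MvPolynomial (Fin n) k} {d : ℕ} :
    f ∈ formPart n k d ↔ f.IsHomogeneous d := by
  constructor
  · intro h γ hγ
    have := h γ hγ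
    rw [weight_one_eq_degree]
    exact_mod_cast this
  · intro h γ hγ
    have := h hγ
    rw [weight_one_eq_degree] at this
    exact_mod_cast this

lemma formPart_natCast (d : ℕ) : formPart n k d = homogeneousSubmodule (Fin n) k d :=
  Submodule.ext fun _ => mem_formPart_natCast

lemma formPart_of_neg {m : ℤ} (hm : m < 0) : formPart n k m = ⊥ := by
  refine (Submodule.eq_bot_iff _).2 fun f hf => ?_
  ext γ
  by_contra h
  have := hf γ h
  omega

lemma mul_mem_formPart {f g : MvPolynomial (Fin n) k} {l m : ℤ} (hf : f ∈ formPart n k l)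
    (hg : g ∈ formPart n k m) : f * g ∈ formPart n k (l + m) := by
  rcases lt_or_ge l 0 with hl | hl
  · rw [formPart_of_neg hl, Submodule.mem_bot] at hf
    rw [hf, zero_mul]
    exact zero_mem _
  rcases lt_or_ge m 0 with hm | hm
  · rw [formPart_of_neg hm, Submodule.mem_bot] at hg
    rw [hg, mul_zero]
    exact zero_mem _
  lift l to ℕ using hl
  lift m to ℕ using hm
  rw [mem_formPart_natCast] at hf hg
  exact_mod_cast mem_formPart_natCast.2 (hf.mul hg)

lemma X_mem_formPart (b : Fin n) : (X b : MvPolynomial (Fin n) k) ∈ formPart n k 1 :=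
  mem_formPart_natCast (d := 1).2 (isHomogeneous_X k b)

lemma C_mem_formPart (c : k) : (C c : MvPolynomial (Fin n) k) ∈ formPart n k 0 :=
  mem_formPart_natCast (d := 0).2 (isHomogeneous_C _ c)

lemma eq_C_of_mem_formPart_zero {f : MvPolynomial (Fin n) k} (hf : f ∈ formPart n k 0) :
    f = C (constantCoeff f) := by
  ext γ
  rw [coeff_C]
  split_ifs with h
  · rw [← h, constantCoeff_eq]
  · by_contra h'
    have := hf γ h'
    rw [Nat.cast_eq_zero, Finsupp.degree_eq_zero_iff] at this
    exact h this.symm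

lemma pderiv_mem_formPart (b : Fin n) {f : MvPolynomial (Fin n) k} {m : ℤ}
    (hf : f ∈ formPart n k m) : pderiv b f ∈ formPart n k (m - 1) := by
  intro γ hγ
  rw [coeff_pderiv] at hγ
  have := hf _ (left_ne_zero_of_mul hγ)
  rw [map_add, Finsupp.degree_single] at this
  push_cast at this
  omega

lemma sum_X_mul_pderiv_of_mem_formPart {f : MvPolynomial (Fin n) k} {m : ℤ}
    (hf : f ∈ formPart n k m) : ∑ b, X b * pderiv b f = (m : k) • f := by
  rcases lt_or_ge m 0 with hm | hm
  · rw [formPart_of_neg hm, Submodule.mem_bot] at hf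
    simp [hf]
  lift m to ℕ using hm
  rw [(mem_formPart_natCast.1 hf).sum_X_mul_pderiv, Int.cast_natCast, Nat.cast_smul_eq_nsmul]

variable (n k) in
/-- The homogeneous component of integral degree `m`. -/
def formProj (m : ℤ) : MvPolynomial (Fin n) k →ₗ[k] MvPolynomial (Fin n) k :=
  -- Without the case split, `toNat` would turn every negative degree into degree 0.
  if 0 ≤ m then homogeneousComponent m.toNat else 0

lemma coeff_formProj (m : ℤ) (f : MvPolynomial (Fin n) k) (γ : Fin n →₀ ℕ) :
    coeff γ (formProj n k m f) = if (γ.degree : ℤ) = m then coeff γ f else 0 := by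
  unfold formProj
  split_ifs with h1 h2 h2
  · rw [coeff_homogeneousComponent, if_pos (by omega)]
  · rw [coeff_homogeneousComponent, if_neg (by omega)]
  · omega
  · rfl

lemma formProj_mem (m : ℤ) (f : MvPolynomial (Fin n) k) : formProj n k m f ∈ formPart n k m := by
  intro γ hγ
  rw [coeff_formProj] at hγ
  by_contra h
  exact hγ (if_neg h)

lemma formProj_eq_self {m : ℤ} {f : MvPolynomial (Fin n) k} (hf : f ∈ formPart n k m) :
    formProj n k m f = f := by
  ext γ
  rw [coeff_formProj]
  split_ifs with h
  · rfl
  · by_contra h'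
    exact h (hf γ (Ne.symm h'))

lemma formProj_mul {e : ℤ} (m : ℤ) (f : MvPolynomial (Fin n) k) {g : MvPolynomial (Fin n) k}
    (hg : g ∈ formPart n k e) : formProj n k m (f * g) = formProj n k (m - e) f * g := by
  ext γ
  rw [coeff_formProj, coeff_mul, coeff_mul]
  have h : ∀ x ∈ Finset.HasAntidiagonal.antidiagonal γ, coeff x.1 (formProj n k (m - e) f) * coeff x.2 g =
      if (γ.degree : ℤ) = m then coeff x.1 f * coeff x.2 g else 0 := by
    intro x hx
    rw [coeff_formProj]
    by_cases hx2 : coeff x.2 g = 0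
    · simp [hx2]
    · have h1 := hg _ hx2
      have h2 : γ.degree = x.1.degree + x.2.degree := by
        rw [← Finset.HasAntidiagonal.mem_antidiagonal.1 hx, map_add]
      have h3 : ((x.1.degree : ℤ) = m - e) ↔ ((γ.degree : ℤ) = m) := by omega
      simp only [h3, ite_mul, zero_mul]
  rw [Finset.sum_congr rfl h]
  split_ifs <;> simp

lemma constantCoeff_eq_zero_iff_mem_idealOfVars {f : MvPolynomial (Fin n) k} :
    constantCoeff f = 0 ↔ f ∈ idealOfVars (Fin n) k := by
  rw [← pow_one (idealOfVars (Fin n) k), mem_pow_idealOfVars_iff', constantCoeff_eq]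
  constructor
  · intro h γ hγ
    rw [Nat.lt_one_iff, Finsupp.degree_eq_zero_iff] at hγ
    rw [hγ, h]
  · intro h
    exact h 0 (by simp)

end Forms

/-! ### The de Rham differential and the acyclicity of the Koszul complex -/

section DeRham

variable {n : ℕ} {k : Type*} [Field k]

/-- The exterior derivative of polynomial differential forms. -/
def deRham (ω : Finset (Fin n) → MvPolynomial (Fin n) k) (T : Finset (Fin n)) :
    MvPolynomial (Fin n) k :=
  ∑ c, if c ∈ T then koszulSign c (T.erase c) • pderiv c (ω (T.erase c)) else 0

/-- Cartan's formula. Terms with b ≠ c cancel by `koszulSign_mixed`. A diagonal term is X_b ∂_b for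
b ∉ T and ∂_b X_b = X_b ∂_b + 1 for b ∈ T, whence the extra summand `T.card`. -/
lemma koszul_deRham_add (ω : Finset (Fin n) → MvPolynomial (Fin n) k) (T : Finset (Fin n)) :
    koszul k (deRham ω) T + deRham (koszul k ω) T =
      ∑ b, X b * pderiv b (ω T) + T.card • ω T := by
  set A : Fin n → Fin n → MvPolynomial (Fin n) k := fun b c => if b ∈ T then 0 else
    koszulSign b T • X b * (if c ∈ insert b T then
      koszulSign c ((insert b T).erase c) • pderiv c (ω ((insert b T).erase c)) else 0) with hA
  set B : Fin n → Fin n → MvPolynomial (Fin n) k := fun b c => if c ∈ T then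
    koszulSign c (T.erase c) • pderiv c (if b ∈ T.erase c then 0 else
      koszulSign b (T.erase c) • (X b * ω (insert b (T.erase c)))) else 0 with hB
  have h1 : koszul k (deRham ω) T = ∑ b, ∑ c, A b c := by
    rw [koszul_apply]
    refine Finset.sum_congr rfl fun b _ => ?_
    simp only [hA]
    split_ifs with hb
    · simp
    · rw [deRham, smul_eq_mul, ← smul_mul_assoc, Finset.mul_sum]
  have h2 : deRham (koszul k ω) T = ∑ b, ∑ c, B b c := by
    rw [Finset.sum_comm, deRham]
    refine Finset.sum_congr rfl fun c _ => ?_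
    simp only [hB]
    split_ifs with hc
    · rw [koszul_apply, map_sum, Finset.smul_sum]
      simp only [smul_eq_mul]
    · simp
  have h3 : ∀ b c, A b c + B b c =
      if b = c then X b * pderiv b (ω T) + (if b ∈ T then ω T else 0) else 0 := by
    intro b c
    by_cases hbc : b = c
    · subst hbc
      by_cases hb : b ∈ T
      · have h : insert b (T.erase b) = T := Finset.insert_erase hb
        simp only [hA, hB, hb, if_true, Finset.notMem_erase, if_false, h, map_zsmul, smul_smul,
          koszulSign_mul_self, one_smul, zero_add, Derivation.leibniz, pderiv_X_self, smul_eq_mul,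
          mul_one]
      · simp only [hA, hB, hb, if_false, Finset.mem_insert_self, if_true,
          Finset.erase_insert hb, add_zero, smul_mul_smul_comm, koszulSign_mul_self, one_smul]
    · rw [if_neg hbc]
      by_cases hb : b ∈ T
      · simp [hA, hB, hb, hbc]
      by_cases hc : c ∈ T
      · obtain ⟨U, hcU, rfl⟩ : ∃ U, c ∉ U ∧ insert c U = T :=
          ⟨T.erase c, Finset.notMem_erase _ _, Finset.insert_erase hc⟩
        have hbU : b ∉ U := fun h => hb (Finset.mem_insert_of_mem h)
        have h : c ∉ insert b U := by simp [hcU, Ne.symm hbc]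
        have h' : c ∈ insert c (insert b U) := Finset.mem_insert_self _ _
        simp only [hA, hB, hb, if_false, hc, if_true, Finset.erase_insert hcU, hbU,
          Finset.insert_comm b c U, h', Finset.erase_insert h]
        rw [map_zsmul, Derivation.leibniz, pderiv_X_of_ne hbc, smul_zero, add_zero, smul_eq_mul,
          smul_smul, smul_mul_smul_comm, koszulSign_mixed hbc hbU hcU, neg_smul, neg_add_cancel]
      · simp [hA, hB, hb, hc, Ne.symm hbc]
  rw [h1, h2, ← Finset.sum_add_distrib]
  simp only [← Finset.sum_add_distrib, h3, Finset.sum_ite_eq, Finset.mem_univ, if_true]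
  rw [Finset.sum_add_distrib, Finset.sum_ite_mem, Finset.univ_inter, Finset.sum_const]

variable {r : ℕ}

/-- The part of degree `j` of the graded free module `⨁ a, S(-deg a)`. -/
def freePart (k : Type*) [Field k] (n : ℕ) {r : ℕ} (deg : Fin r → ℤ) (j : ℤ) :
    Submodule k (Fin r → MvPolynomial (Fin n) k) :=
  Submodule.pi Set.univ fun a => formPart n k (j - deg a)

lemma mem_freePart {deg : Fin r → ℤ} {j : ℤ} {v : Fin r → MvPolynomial (Fin n) k} :
    v ∈ freePart k n deg j ↔ ∀ a, v a ∈ formPart n k (j - deg a) := by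
  simp [freePart, Submodule.mem_pi]

lemma isGradedFamily_freePart (deg : Fin r → ℤ) : IsGradedFamily n (freePart k n deg) := by
  intro b j v hv
  rw [mem_freePart] at hv ⊢
  intro a
  have := mul_mem_formPart (X_mem_formPart b) (hv a)
  rwa [show 1 + (j - deg a) = j + 1 - deg a by ring] at this

lemma deRham_mem {p : ℕ} {j : ℤ} {ω : Finset (Fin n) → MvPolynomial (Fin n) k}
    (hω : ω ∈ koszulPart (formPart n k) p j) :
    deRham ω ∈ koszulPart (formPart n k) (p + 1) j := by
  intro T
  rw [deRham]
  constructor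
  · intro hT
    refine Submodule.sum_mem _ fun c _ => ?_
    split_ifs with hc
    · refine zsmul_mem ?_ _
      have := pderiv_mem_formPart c ((hω (T.erase c)).1 (by rw [Finset.card_erase_of_mem hc]; omega))
      rwa [show j - (p : ℤ) - 1 = j - ((p + 1 : ℕ) : ℤ) by push_cast; ring] at this
    · exact zero_mem _
  · intro hT
    refine Finset.sum_eq_zero fun c _ => ?_
    split_ifs with hc
    · have h0 : 0 < T.card := Finset.card_pos.2 ⟨c, hc⟩
      rw [(hω (T.erase c)).2 (by rw [Finset.card_erase_of_mem hc]; omega), map_zero, smul_zero]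
    · rfl

/-- By Euler's formula the coefficients contribute j - p and the cardinality of T contributes p: up
to the factor j, the de Rham differential is a contracting homotopy. -/
lemma koszul_deRham_of_cycle {p : ℕ} {j : ℤ} {ω : Finset (Fin n) → MvPolynomial (Fin n) k}
    (hω : ω ∈ koszulPart (formPart n k) p j) (h : koszul k ω = 0) :
    koszul k (deRham ω) = (j : k) • ω := by
  ext1 T
  have h1 := koszul_deRham_add ω T
  have h2 : deRham (koszul k ω) T = 0 := by
    rw [h, deRham]
    exact Finset.sum_eq_zero fun c _ => by simp
  rw [h2, add_zero] at h1
  rw [h1, Pi.smul_apply]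
  by_cases hT : T.card = p
  · rw [sum_X_mul_pderiv_of_mem_formPart ((hω T).1 hT), hT, ← Nat.cast_smul_eq_nsmul k, ← add_smul]
    congr 1
    push_cast
    ring
  · rw [(hω T).2 hT]
    simp

/-- The Koszul complex of a graded free module is acyclic away from the generators. -/
lemma mem_koszulBoundaries_freePart [CharZero k] (deg : Fin r → ℤ) {p : ℕ} {j : ℤ}
    {ω : Finset (Fin n) → Fin r → MvPolynomial (Fin n) k}
    (hω : ω ∈ koszulCycles (freePart k n deg) p j) (h0 : ∀ T a, j = deg a → ω T a = 0) :
    ω ∈ koszulBoundaries (freePart k n deg) p j := by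
  have hωa : ∀ a, (fun T => ω T a) ∈ koszulPart (formPart n k) p (j - deg a) := by
    intro a T
    refine ⟨fun hT => ?_, fun hT => by simp only [(hω.1 T).2 hT, Pi.zero_apply]⟩
    have := mem_freePart.1 ((hω.1 T).1 hT) a
    rwa [show j - (p : ℤ) - deg a = j - deg a - p by ring] at this
  have hcyc : ∀ a, koszul k (fun T => ω T a) = 0 := by
    intro a
    have := koszul_map (k := k)
      (LinearMap.proj (R := MvPolynomial (Fin n) k) (φ := fun _ : Fin r => MvPolynomial (Fin n) k) a)
      ω
    have h' : koszul k ω = 0 := hω.2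
    rw [h'] at this
    exact this
  -- The summand S(-deg a) is S shifted, so the homotopy factor there is j - deg a. When this is 0
  -- the inverse is 0 as well, which is correct because `h0` makes that component of ω vanish.
  refine ⟨fun T a => ((j - deg a : ℤ) : k)⁻¹ • deRham (fun T => ω T a) T, ?_, ?_⟩
  · intro T
    constructor
    · intro hT
      rw [mem_freePart]
      intro a
      have := ((deRham_mem (hωa a)) T).1 hT
      rw [show j - deg a - ((p + 1 : ℕ) : ℤ) = j - ((p + 1 : ℕ) : ℤ) - deg a by ring] at this
      exact Submodule.smul_mem _ _ this
    · intro hT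
      ext1 a
      simp only [((deRham_mem (hωa a)) T).2 hT, smul_zero, Pi.zero_apply]
  · ext1 T
    ext1 a
    have h1 := koszul_map (k := k)
      (LinearMap.proj (R := MvPolynomial (Fin n) k) (φ := fun _ : Fin r => MvPolynomial (Fin n) k) a)
      (fun T a => ((j - deg a : ℤ) : k)⁻¹ • deRham (fun T => ω T a) T)
    refine (congrFun h1 T).symm.trans ?_
    change koszul k (((j - deg a : ℤ) : k)⁻¹ • deRham (fun T => ω T a)) T = ω T a
    rw [map_smul, koszul_deRham_of_cycle (hωa a) (hcyc a), smul_smul, Pi.smul_apply]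
    by_cases hj : j = deg a
    · rw [h0 T a hj, smul_zero]
    · rw [inv_mul_cancel₀, one_smul]
      exact Int.cast_ne_zero.2 (sub_ne_zero.2 hj)

/-- In the excluded case j = deg a the coefficients have degree -(p + 1) < 0, so they vanish anyway.
-/
lemma koszulCycles_freePart_le [CharZero k] (deg : Fin r → ℤ) (p : ℕ) (j : ℤ) :
    koszulCycles (n := n) (freePart k n deg) (p + 1) j ≤ koszulBoundaries (freePart k n deg) (p + 1) j := by
  refine fun ω hω => mem_koszulBoundaries_freePart deg hω fun T a hj => ?_
  by_cases hT : T.card = p + 1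
  · have := mem_freePart.1 ((hω.1 T).1 hT) a
    rw [formPart_of_neg (by push_cast; omega), Submodule.mem_bot] at this
    exact this
  · rw [(hω.1 T).2 hT, Pi.zero_apply]

/-- The boundaries in homological degree 0 are 𝔪F. In degree j a constant term can occur only at a
generator with deg a = j. -/
lemma mem_koszulBoundaries_freePart_zero_iff [CharZero k] (deg : Fin r → ℤ) {j : ℤ}
    {ω : Finset (Fin n) → Fin r → MvPolynomial (Fin n) k}
    (hω : ω ∈ koszulPart (freePart k n deg) 0 j) :
    ω ∈ koszulBoundaries (freePart k n deg) 0 j ↔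
      ∀ a, deg a = j → constantCoeff (ω ∅ a) = 0 := by
  constructor
  · rintro ⟨η, hη, rfl⟩ a _
    rw [koszul_apply, Finset.sum_apply, map_sum]
    refine Finset.sum_eq_zero fun b _ => ?_
    simp
  · intro h
    refine mem_koszulBoundaries_freePart deg ⟨hω, koszul_eq_zero_of_mem_zero hω⟩ fun T a hj => ?_
    by_cases hT : T = ∅
    · have h1 := mem_freePart.1 ((hω T).1 (by simp [hT])) a
      rw [show j - ((0 : ℕ) : ℤ) - deg a = 0 by simp [hj]] at h1
      rw [eq_C_of_mem_formPart_zero h1, hT, h a hj.symm, C_0]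
    · rw [(hω T).2 (by simpa using hT), Pi.zero_apply]

/-- The homology in degree 0 is F/𝔪F, and the constant terms at the generators of degree j are its
coordinates. -/
lemma koszulBetti_freePart_zero [CharZero k] (deg : Fin r → ℤ) (j : ℤ) :
    koszulBetti n (freePart k n deg) 0 j = Fintype.card {a // deg a = j} := by
  let f : koszulCycles (n := n) (freePart k n deg) 0 j →ₗ[k] ({a // deg a = j} → k) :=
    LinearMap.pi fun a => (lcoeff k (0 : Fin n →₀ ℕ)) ∘ₗ LinearMap.proj a.1 ∘ₗ
      LinearMap.proj (∅ : Finset (Fin n)) ∘ₗ Submodule.subtype _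
  have hf : ∀ ω a, f ω a = constantCoeff (ω.1 ∅ a.1) := fun ω a => rfl
  have key := finrank_quotient_eq_of_surjective LinearMap.id f
    ((koszulBoundaries (freePart k n deg) 0 j).submoduleOf
      (koszulCycles (freePart k n deg) 0 j)) ⊥ Function.surjective_id ?_ ?_
  · rw [koszulBetti, key, LinearEquiv.finrank_eq (Submodule.quotEquivOfEqBot _ rfl),
      Module.finrank_fintype_fun_eq_card]
  · intro c
    set ω : Finset (Fin n) → Fin r → MvPolynomial (Fin n) k :=
      fun T a => if T = ∅ then (if h : deg a = j then C (c ⟨a, h⟩) else 0) else 0 with hω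
    have hω' : ω ∈ koszulPart (freePart k n deg) 0 j := by
      intro T
      constructor
      · intro hT
        rw [Finset.card_eq_zero] at hT
        rw [mem_freePart]
        intro a
        simp only [hω, hT, if_true]
        split_ifs with h
        · convert C_mem_formPart (n := n) (c ⟨a, h⟩) using 2
          simp [h]
        · exact zero_mem _
      · intro hT
        rw [Ne, Finset.card_eq_zero] at hT
        ext1 a
        simp [hω, hT]
    refine ⟨⟨ω, hω', koszul_eq_zero_of_mem_zero hω'⟩, ?_⟩
    ext a
    rw [hf]
    simp [hω, a.2]
  · rintro ⟨ω, hω⟩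
    rw [Submodule.mem_bot]
    refine (mem_koszulBoundaries_freePart_zero_iff deg hω.1).trans ?_
    rw [funext_iff]
    simp only [hf, Subtype.forall]
    rfl

end DeRham

/-! ### Graded maps of free modules -/

section GradedMaps

variable {n : ℕ} {k : Type*} [Field k] {r r' : ℕ}
  {N : Type*} [AddCommGroup N] [Module (MvPolynomial (Fin n) k) N] [Module k N]
  [IsScalarTower k (MvPolynomial (Fin n) k) N]

/-- The homogeneous component of degree `j` in a graded free module. -/
def freeProj (k : Type*) [Field k] (n : ℕ) {r : ℕ} (deg : Fin r → ℤ) (j : ℤ) :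
    (Fin r → MvPolynomial (Fin n) k) →ₗ[k] (Fin r → MvPolynomial (Fin n) k) :=
  LinearMap.pi fun a => formProj n k (j - deg a) ∘ₗ LinearMap.proj a

lemma freeProj_apply (deg : Fin r → ℤ) (j : ℤ) (v : Fin r → MvPolynomial (Fin n) k) (a : Fin r) :
    freeProj k n deg j v a = formProj n k (j - deg a) (v a) := rfl

lemma freeProj_mem (deg : Fin r → ℤ) (j : ℤ) (v : Fin r → MvPolynomial (Fin n) k) :
    freeProj k n deg j v ∈ freePart k n deg j :=
  mem_freePart.2 fun _ => formProj_mem _ _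

lemma freeProj_eq_self {deg : Fin r → ℤ} {j : ℤ} {v : Fin r → MvPolynomial (Fin n) k}
    (hv : v ∈ freePart k n deg j) : freeProj k n deg j v = v :=
  funext fun a => formProj_eq_self (mem_freePart.1 hv a)

lemma exists_sum_freeProj (deg : Fin r → ℤ) (v : Fin r → MvPolynomial (Fin n) k) :
    ∃ J : Finset ℤ, ∑ j ∈ J, freeProj k n deg j v = v := by
  refine ⟨Finset.univ.biUnion fun a => (v a).support.image fun γ => (γ.degree : ℤ) + deg a, ?_⟩
  ext a γ
  rw [Finset.sum_apply, coeff_sum]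
  simp only [freeProj_apply, coeff_formProj]
  have : ∀ j : ℤ, ((γ.degree : ℤ) = j - deg a) ↔ ((γ.degree : ℤ) + deg a = j) := fun j => by omega
  simp only [this]
  rw [Finset.sum_ite_eq]
  split_ifs with h
  · rfl
  · by_contra h'
    refine h (Finset.mem_biUnion.2 ⟨a, Finset.mem_univ a, Finset.mem_image.2 ⟨γ, ?_, rfl⟩⟩)
    exact mem_support_iff.2 (Ne.symm h')

omit [Module k N] [IsScalarTower k (MvPolynomial (Fin n) k) N] in
lemma linearMap_apply_eq_sum (g : (Fin r → MvPolynomial (Fin n) k) →ₗ[MvPolynomial (Fin n) k] N)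
    (v : Fin r → MvPolynomial (Fin n) k) : g v = ∑ b, v b • g (Pi.single b 1) := by
  conv_lhs => rw [pi_eq_sum_univ' v]
  rw [map_sum]
  refine Finset.sum_congr rfl fun b _ => ?_
  rw [map_smul]

variable {deg : Fin r → ℤ} {deg' : Fin r' → ℤ}
  {d : (Fin r' → MvPolynomial (Fin n) k) →ₗ[MvPolynomial (Fin n) k]
    (Fin r → MvPolynomial (Fin n) k)}
  {g : (Fin r → MvPolynomial (Fin n) k) →ₗ[MvPolynomial (Fin n) k] N}

lemma freeProj_map (hd : ∀ b a, IsOfDegree (d (Pi.single b 1) a) (deg' b - deg a)) (j : ℤ)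
    (v : Fin r' → MvPolynomial (Fin n) k) :
    freeProj k n deg j (d v) = d (freeProj k n deg' j v) := by
  rw [linearMap_apply_eq_sum d v, linearMap_apply_eq_sum d (freeProj k n deg' j v)]
  ext1 a
  rw [freeProj_apply, Finset.sum_apply, Finset.sum_apply, map_sum]
  refine Finset.sum_congr rfl fun b _ => ?_
  rw [Pi.smul_apply, smul_eq_mul, formProj_mul _ _ (mem_formPart.2 (hd b a)), Pi.smul_apply,
    smul_eq_mul, freeProj_apply]
  congr 3
  ring

lemma map_freePart_eq (hd : ∀ b a, IsOfDegree (d (Pi.single b 1) a) (deg' b - deg a))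
    (hex : Function.Exact d g) (j : ℤ) :
    (freePart k n deg' j).map (d.restrictScalars k) =
      freePart k n deg j ⊓ LinearMap.ker (g.restrictScalars k) := by
  ext v
  constructor
  · rintro ⟨w, hw, rfl⟩
    refine ⟨?_, (hex _).2 ⟨w, rfl⟩⟩
    have := freeProj_map hd j w
    rw [freeProj_eq_self hw] at this
    change d w ∈ freePart k n deg j
    rw [← this]
    exact freeProj_mem _ _ _
  · rintro ⟨hv, hv'⟩
    obtain ⟨w, rfl⟩ := (hex v).1 hv'
    exact ⟨freeProj k n deg' j w, freeProj_mem _ _ _, by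
      change d _ = _
      rw [← freeProj_map hd, freeProj_eq_self hv]⟩

/-- This is where minimality enters: ker g is the image of d, which lies in 𝔪F. -/
lemma koszulPart_ker_le [CharZero k]
    (hex : Function.Exact d g) (hmin : ∀ v a, d v a ∈ idealOfVars (Fin n) k) (j : ℤ) :
    koszulPart (n := n) (fun i => freePart k n deg i ⊓ LinearMap.ker (g.restrictScalars k)) 0 j ≤
      koszulBoundaries (freePart k n deg) 0 j := by
  intro ω hω
  obtain ⟨h1, h2⟩ := (koszulPart_inf_ker _ _ _ _ _).1 hω
  refine (mem_koszulBoundaries_freePart_zero_iff deg h1).2 fun a _ => ?_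
  obtain ⟨w, hw⟩ := (hex _).1 (h2 ∅)
  rw [← hw]
  exact constantCoeff_eq_zero_iff_mem_idealOfVars.2 (hmin w a)

/-- One step of dimension shifting. That cycles of ker g bound in F follows from minimality when p =
0 and from acyclicity of F when p > 0. -/
lemma koszulBetti_map_succ [CharZero k]
    (hd : ∀ b a, IsOfDegree (d (Pi.single b 1) a) (deg' b - deg a))
    (hex : Function.Exact d g) (hmin : ∀ v a, d v a ∈ idealOfVars (Fin n) k) (p : ℕ) (j : ℤ) :
    koszulBetti n (fun i => (freePart k n deg i).map (g.restrictScalars k)) (p + 1) j =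
      koszulBetti n (fun i => (freePart k n deg' i).map (d.restrictScalars k)) p j := by
  simp only [map_freePart_eq hd hex]
  refine koszulBetti_map_eq_ker (isGradedFamily_freePart deg) g p j
    (koszulCycles_freePart_le deg p j) ?_
  cases p with
  | zero => exact fun ω hω => koszulPart_ker_le hex hmin j hω.1
  | succ p =>
    exact fun ω hω => koszulCycles_freePart_le deg _ j
      ⟨koszulPart_mono (fun _ => inf_le_left) hω.1, hω.2⟩

lemma koszulBetti_map_zero_eq_card [CharZero k]
    (hex : Function.Exact d g) (hmin : ∀ v a, d v a ∈ idealOfVars (Fin n) k) (j : ℤ) :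
    koszulBetti n (fun i => (freePart k n deg i).map (g.restrictScalars k)) 0 j =
      Fintype.card {a // deg a = j} := by
  rw [koszulBetti_map_zero (isGradedFamily_freePart deg) g j (koszulPart_ker_le hex hmin j),
    koszulBetti_freePart_zero]

end GradedMaps

/-! ### The graded Betti numbers of a minimal resolution -/

section Betti

variable {n : ℕ} {k : Type*} [Field k] {I : Ideal (MvPolynomial (Fin n) k)}

/-- The graded pieces of `S/I`. -/
def quotPart (I : Ideal (MvPolynomial (Fin n) k)) (j : ℤ) :
    Submodule k (MvPolynomial (Fin n) k ⧸ I) :=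
  (formPart n k j).map (Ideal.Quotient.mkₐ k I).toLinearMap

namespace GradedFreeResolution

lemma map_aug_eq (F : GradedFreeResolution I)
    (hI : ∀ (m : ℤ), ∀ f ∈ I, formProj n k m f ∈ I) (j : ℤ) :
    (freePart k n (F.deg 0) j).map (F.aug.restrictScalars k) = quotPart I j := by
  choose f hf hf' using F.aug_degree
  have haug : ∀ v, F.aug v = Ideal.Quotient.mk I (∑ a, v a * f a) := by
    intro v
    rw [linearMap_apply_eq_sum, map_sum]
    refine Finset.sum_congr rfl fun a _ => ?_
    rw [hf', map_mul]
    rfl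
  ext x
  constructor
  · rintro ⟨v, hv, rfl⟩
    refine ⟨∑ a, v a * f a, Submodule.sum_mem _ fun a _ => ?_, (haug v).symm⟩
    have := mul_mem_formPart (mem_freePart.1 hv a) (mem_formPart.2 (hf a))
    rwa [sub_add_cancel] at this
  · rintro ⟨h, hh, rfl⟩
    obtain ⟨w, hw⟩ := F.aug_surjective (Ideal.Quotient.mk I h)
    -- The preimage w need not be homogeneous; since I is, its component of degree j still maps to
    -- the class of h.
    refine ⟨freeProj k n (F.deg 0) j w, freeProj_mem _ _ _, ?_⟩
    change F.aug _ = Ideal.Quotient.mk I h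
    rw [haug] at hw ⊢
    rw [Ideal.Quotient.eq] at hw ⊢
    have := hI j _ hw
    rw [map_sub, formProj_eq_self hh, map_sum] at this
    convert this using 3 with a
    rw [formProj_mul _ _ (mem_formPart.2 (hf a)), freeProj_apply]

/-- The number of generators of degree `j` of the `i`-th module of a minimal resolution is the
dimension of the Koszul homology of `S/I`. -/
lemma card_deg_eq_koszulBetti [CharZero k] (F : GradedFreeResolution I) (hF : F.IsMinimal)
    (hI : ∀ (m : ℤ), ∀ f ∈ I, formProj n k m f ∈ I) (i : ℕ) (j : ℤ) :
    Fintype.card {a // F.deg i a = j} = koszulBetti n (quotPart I) i j := by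
  -- Each shift lowers the homological degree by one and moves one place along the resolution, so
  -- the induction on p must hold for all i.
  have key : ∀ p i, koszulBetti n
      (fun l => (freePart k n (F.deg (i + 1)) l).map ((F.d i).restrictScalars k)) p j =
      Fintype.card {a // F.deg (i + p + 1) a = j} := by
    intro p
    induction p with
    | zero => exact fun i => koszulBetti_map_zero_eq_card (F.exact_d i) (hF (i + 1)) j
    | succ p ih =>
      intro i
      rw [koszulBetti_map_succ (F.d_degree (i + 1)) (F.exact_d i) (hF (i + 1)), ih,
        show i + 1 + p + 1 = i + (p + 1) + 1 by ring]
  have h : quotPart I = fun l => (freePart k n (F.deg 0) l).map (F.aug.restrictScalars k) :=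
    funext fun l => (F.map_aug_eq hI l).symm
  rw [h]
  cases i with
  | zero => exact (koszulBetti_map_zero_eq_card F.exact_aug (hF 0) j).symm
  | succ p =>
    rw [koszulBetti_map_succ (F.d_degree 0) F.exact_aug (hF 0), key, zero_add]

lemma count_twists (F : GradedFreeResolution I) (i : ℕ) (j : ℤ) :
    (F.twists i).count j = Fintype.card {a // F.deg i a = j} := by
  rw [twists, Multiset.count_map, Fintype.card_subtype, Finset.card_def, Finset.filter_val]
  simp only [eq_comm]

end GradedFreeResolution

end Betti

/-! ### Existence of minimal resolutions -/

section Existence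

variable {n : ℕ} {k : Type*} [Field k] {r : ℕ}

/-- K is generated by the homogeneous components of its elements, and finitely many of these suffice
because the free module is Noetherian. -/
lemma exists_homogeneous_generators (deg : Fin r → ℤ)
    (K : Submodule (MvPolynomial (Fin n) k) (Fin r → MvPolynomial (Fin n) k))
    (hK : ∀ (j : ℤ), ∀ v ∈ K, freeProj k n deg j v ∈ K) :
    ∃ (m : ℕ) (e : Fin m → Fin r → MvPolynomial (Fin n) k) (deg' : Fin m → ℤ),
      (∀ b, e b ∈ freePart k n deg (deg' b)) ∧
        Submodule.span (MvPolynomial (Fin n) k) (Set.range e) = K := by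
  set s : Set (Fin r → MvPolynomial (Fin n) k) := {v | v ∈ K ∧ ∃ j, v ∈ freePart k n deg j}
  have hs : Submodule.span (MvPolynomial (Fin n) k) s = K := by
    refine le_antisymm (Submodule.span_le.2 fun v hv => hv.1) fun v hv => ?_
    obtain ⟨J, hJ⟩ := exists_sum_freeProj deg v
    rw [← hJ]
    exact Submodule.sum_mem _ fun j _ =>
      Submodule.subset_span ⟨hK j v hv, j, freeProj_mem _ _ _⟩
  obtain ⟨t, hts, ht⟩ := (Submodule.fg_span_iff_fg_span_finset_subset s).1
    (IsNoetherian.noetherian (R := MvPolynomial (Fin n) k) _)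
  have hdeg : ∀ b : Fin t.card, ∃ j, (t.equivFin.symm b : Fin r → MvPolynomial (Fin n) k) ∈
      freePart k n deg j := fun b => (hts (t.equivFin.symm b).2).2
  choose deg' hdeg' using hdeg
  refine ⟨t.card, fun b => t.equivFin.symm b, deg', hdeg', ?_⟩
  rw [← hs, ht]
  congr 1
  ext v
  constructor
  · rintro ⟨b, rfl⟩
    exact (t.equivFin.symm b).2
  · intro hv
    exact ⟨t.equivFin ⟨v, hv⟩, by simp⟩

/-- A graded submodule of a graded free module has a minimal cover by a graded free module. -/
lemma exists_minimal_cover (deg : Fin r → ℤ)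
    (K : Submodule (MvPolynomial (Fin n) k) (Fin r → MvPolynomial (Fin n) k))
    (hK : ∀ (j : ℤ), ∀ v ∈ K, freeProj k n deg j v ∈ K) :
    ∃ (r' : ℕ) (deg' : Fin r' → ℤ)
      (d : (Fin r' → MvPolynomial (Fin n) k) →ₗ[MvPolynomial (Fin n) k]
        (Fin r → MvPolynomial (Fin n) k)),
      (∀ b a, IsOfDegree (d (Pi.single b 1) a) (deg' b - deg a)) ∧ LinearMap.range d = K ∧
        ∀ v, d v = 0 → ∀ a, v a ∈ idealOfVars (Fin n) k := by
  classical
  have hex := exists_homogeneous_generators deg K hK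
  obtain ⟨m, ⟨e, deg', he, hspan⟩, hmin⟩ : ∃ m, (∃ (e : Fin m → Fin r → MvPolynomial (Fin n) k)
      (deg' : Fin m → ℤ), (∀ b, e b ∈ freePart k n deg (deg' b)) ∧
        Submodule.span (MvPolynomial (Fin n) k) (Set.range e) = K) ∧
      ∀ l < m, ¬ ∃ (e : Fin l → Fin r → MvPolynomial (Fin n) k)
      (deg' : Fin l → ℤ), (∀ b, e b ∈ freePart k n deg (deg' b)) ∧
        Submodule.span (MvPolynomial (Fin n) k) (Set.range e) = K :=
    ⟨Nat.find hex, Nat.find_spec hex, fun l => Nat.find_min hex⟩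
  set d := Fintype.linearCombination (MvPolynomial (Fin n) k) e with hd
  have hde : ∀ b, d (Pi.single b 1) = e b := fun b => by
    rw [hd, Fintype.linearCombination_apply_single, one_smul]
  have hdeg : ∀ b a, IsOfDegree (d (Pi.single b 1) a) (deg' b - deg a) := fun b a => by
    rw [hde]
    exact mem_freePart.1 (he b) a
  refine ⟨m, deg', d, hdeg, by rw [hd, Fintype.range_linearCombination, hspan], ?_⟩
  intro v hv a
  rw [← constantCoeff_eq_zero_iff_mem_idealOfVars]
  by_contra hc
  -- If a syzygy v has a nonzero constant term at a, its component of degree deg' a has exactly that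
  -- constant as coefficient at a. Then e a is a combination of the other generators, against the
  -- minimality of their number.
  set w := freeProj k n deg' (deg' a) v with hw
  have hdw : d w = 0 := by rw [hw, ← freeProj_map hdeg, hv, map_zero]
  have hwa : w a = C (constantCoeff (v a)) := by
    have h0 : w a ∈ formPart n k 0 := by
      have := formProj_mem (n := n) (deg' a - deg' a) (v a)
      rw [sub_self] at this
      rw [hw, freeProj_apply, sub_self]
      exact this
    rw [eq_C_of_mem_formPart_zero h0]
    congr 1
    rw [hw, freeProj_apply, constantCoeff_eq, coeff_formProj]
    simp
  obtain ⟨l, rfl⟩ : ∃ l, m = l + 1 := Nat.exists_eq_succ_of_ne_zero (by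
    rintro rfl
    exact a.elim0)
  refine hmin l (Nat.lt_succ_self l) ⟨fun b => e (a.succAbove b), fun b => deg' (a.succAbove b),
    fun b => he _, ?_⟩
  have hea : e a ∈ Submodule.span (MvPolynomial (Fin n) k)
      (Set.range fun b => e (a.succAbove b)) := by
    rw [linearMap_apply_eq_sum, Fin.sum_univ_succAbove _ a, hwa] at hdw
    simp only [hde] at hdw
    have h1 : (C (constantCoeff (v a))⁻¹ : MvPolynomial (Fin n) k) •
        (C (constantCoeff (v a)) : MvPolynomial (Fin n) k) • e a = e a := by
      rw [smul_smul, ← C_mul, inv_mul_cancel₀ hc, C_1, one_smul]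
    rw [← h1, eq_neg_of_add_eq_zero_left hdw]
    exact Submodule.smul_mem _ _ (neg_mem (Submodule.sum_mem _ fun b _ =>
      Submodule.smul_mem _ _ (Submodule.subset_span ⟨b, rfl⟩)))
  refine le_antisymm ?_ ?_
  · rw [← hspan]
    refine Submodule.span_mono ?_
    rintro _ ⟨b, rfl⟩
    exact ⟨_, rfl⟩
  · rw [← hspan, Submodule.span_le]
    rintro _ ⟨b, rfl⟩
    rcases eq_or_ne b a with rfl | hb
    · exact hea
    · obtain ⟨c, rfl⟩ := Fin.exists_succAbove_eq hb
      exact Submodule.subset_span ⟨c, rfl⟩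

/-- A graded map of graded free modules. -/
structure GradedFreeMap (n : ℕ) (k : Type*) [Field k] where
  /-- the rank of the target -/
  rank : ℕ
  /-- the degrees of the basis of the target -/
  deg : Fin rank → ℤ
  /-- the rank of the source -/
  rank' : ℕ
  /-- the degrees of the basis of the source -/
  deg' : Fin rank' → ℤ
  /-- the map -/
  d : (Fin rank' → MvPolynomial (Fin n) k) →ₗ[MvPolynomial (Fin n) k]
    (Fin rank → MvPolynomial (Fin n) k)
  d_degree : ∀ b a, IsOfDegree (d (Pi.single b 1) a) (deg' b - deg a)

namespace GradedFreeMap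

lemma exists_next (s : GradedFreeMap n k) :
    ∃ (r' : ℕ) (deg' : Fin r' → ℤ)
      (d : (Fin r' → MvPolynomial (Fin n) k) →ₗ[MvPolynomial (Fin n) k]
        (Fin s.rank' → MvPolynomial (Fin n) k)),
      (∀ b a, IsOfDegree (d (Pi.single b 1) a) (deg' b - s.deg' a)) ∧
        LinearMap.range d = LinearMap.ker s.d ∧
        ∀ v, d v = 0 → ∀ a, v a ∈ idealOfVars (Fin n) k :=
  exists_minimal_cover s.deg' (LinearMap.ker s.d) fun j v hv => by
    rw [LinearMap.mem_ker] at hv ⊢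
    rw [← freeProj_map s.d_degree, hv, map_zero]

/-- A minimal cover of the kernel of a graded map. -/
def next (s : GradedFreeMap n k) : GradedFreeMap n k where
  rank := s.rank'
  deg := s.deg'
  rank' := s.exists_next.choose
  deg' := s.exists_next.choose_spec.choose
  d := s.exists_next.choose_spec.choose_spec.choose
  d_degree := s.exists_next.choose_spec.choose_spec.choose_spec.1

lemma exact_next (s : GradedFreeMap n k) :
    Function.Exact (s.next.d : (Fin s.next.rank' → MvPolynomial (Fin n) k) →ₗ[MvPolynomial (Fin n) k]
      (Fin s.rank' → MvPolynomial (Fin n) k)) s.d :=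
  LinearMap.exact_iff.2 s.exists_next.choose_spec.choose_spec.choose_spec.2.1.symm

lemma next_minimal (s : GradedFreeMap n k) :
    ∀ v, s.next.d v = 0 → ∀ a, v a ∈ idealOfVars (Fin n) k :=
  s.exists_next.choose_spec.choose_spec.choose_spec.2.2

/-- The iterated minimal covers. -/
def iter (s : GradedFreeMap n k) : ℕ → GradedFreeMap n k
  | 0 => s
  | i + 1 => (s.iter i).next

end GradedFreeMap

/-- Minimal graded free resolutions exist. -/
theorem exists_isMinimal (I : Ideal (MvPolynomial (Fin n) k))
    (hI : ∀ (m : ℤ), ∀ f ∈ I, formProj n k m f ∈ I) (hI0 : I ≤ idealOfVars (Fin n) k) :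
    ∃ F : GradedFreeResolution I, F.IsMinimal := by
  let aug : (Fin 1 → MvPolynomial (Fin n) k) →ₗ[MvPolynomial (Fin n) k]
      (MvPolynomial (Fin n) k ⧸ I) := I.mkQ ∘ₗ LinearMap.proj 0
  have haug : ∀ v, aug v = 0 ↔ v 0 ∈ I := fun v => Submodule.Quotient.mk_eq_zero I
  obtain ⟨r', deg', d, hd, hrange, hker⟩ := exists_minimal_cover (fun _ : Fin 1 => 0)
    (LinearMap.ker aug) (fun j v hv => by
      rw [LinearMap.mem_ker, haug] at hv ⊢
      exact hI _ _ hv)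
  let s : GradedFreeMap n k := ⟨1, fun _ => 0, r', deg', d, hd⟩
  have hkers : ∀ i, ∀ v, (s.iter i).d v = 0 → ∀ a, v a ∈ idealOfVars (Fin n) k := by
    intro i
    cases i with
    | zero => exact hker
    | succ i => exact (s.iter i).next_minimal
  have hex : ∀ i, Function.Exact (s.iter (i + 1)).d
      ((s.iter i).d : (Fin (s.iter (i + 1)).rank → MvPolynomial (Fin n) k) →ₗ[
        MvPolynomial (Fin n) k] (Fin (s.iter i).rank → MvPolynomial (Fin n) k)) :=
    fun i => (s.iter i).exact_next
  have hexaug : Function.Exact d aug := LinearMap.exact_iff.2 hrange.symm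
  have haugdeg : ∀ a : Fin 1, ∃ f : MvPolynomial (Fin n) k, IsOfDegree f 0 ∧
      aug (Pi.single a 1) = Ideal.Quotient.mk I f := by
    refine fun a => ⟨1, mem_formPart.1 ?_, ?_⟩
    · have := C_mem_formPart (n := n) (1 : k)
      rwa [C_1] at this
    · change Ideal.Quotient.mk I ((Pi.single a 1 : Fin 1 → MvPolynomial (Fin n) k) 0) = _
      rw [Subsingleton.elim a 0, Pi.single_eq_same]
  have hd0 : ∀ v, ∀ a : Fin 1, d v a ∈ idealOfVars (Fin n) k := by
    intro v a
    have h : d v ∈ LinearMap.ker aug := hrange ▸ LinearMap.mem_range_self d v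
    rw [Subsingleton.elim a 0]
    exact hI0 ((haug _).1 h)
  let F : GradedFreeResolution I :=
    { rank := fun i => (s.iter i).rank
      deg := fun i => (s.iter i).deg
      d := fun i => (s.iter i).d
      aug := aug
      d_degree := fun i => (s.iter i).d_degree
      aug_degree := haugdeg
      aug_surjective := fun x => by
        obtain ⟨f, rfl⟩ := Ideal.Quotient.mk_surjective x
        exact ⟨fun _ => f, rfl⟩
      exact_aug := hexaug
      exact_d := hex }
  refine ⟨F, fun i => ?_⟩
  cases i with
  | zero => exact hd0
  | succ i => exact fun v => hkers i _ ((hex i _).2 ⟨v, rfl⟩)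

end Existence

/-! ### Ranks in the Koszul complex -/

section PartRank

variable {n : ℕ} {k : Type*} [Field k] {M : Type*} [AddCommGroup M] [Module k M]

variable (n) in
/-- A graded piece of the Koszul complex is a power of a graded piece of the module. -/
def koszulPartEquiv (𝓜 : ℤ → Submodule k M) (p : ℕ) (j : ℤ) :
    koszulPart (n := n) 𝓜 p j ≃ₗ[k] ({T : Finset (Fin n) // T.card = p} → 𝓜 (j - p)) where
  toFun ω T := ⟨ω.1 T.1, (ω.2 T.1).1 T.2⟩
  map_add' _ _ := rfl
  map_smul' _ _ := rfl
  invFun c := ⟨fun T => if h : T.card = p then (c ⟨T, h⟩ : M) else 0, fun T =>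
    ⟨fun h => by simp only [dif_pos h, SetLike.coe_mem], fun h => dif_neg h⟩⟩
  left_inv ω := by
    ext T
    by_cases h : T.card = p
    · simp [h]
    · simp only [dif_neg h]
      exact ((ω.2 T).2 h).symm
  right_inv c := by
    ext T
    simp [T.2]

instance finite_koszulPart (𝓜 : ℤ → Submodule k M) [∀ i, Module.Finite k (𝓜 i)] (p : ℕ) (j : ℤ) :
    Module.Finite k (koszulPart (n := n) 𝓜 p j) :=
  Module.Finite.equiv (koszulPartEquiv n 𝓜 p j).symm

lemma finrank_koszulPart (𝓜 : ℤ → Submodule k M) [∀ i, Module.Finite k (𝓜 i)] (p : ℕ) (j : ℤ) :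
    Module.finrank k (koszulPart (n := n) 𝓜 p j) =
      n.choose p * Module.finrank k (𝓜 (j - p)) := by
  rw [LinearEquiv.finrank_eq (koszulPartEquiv n 𝓜 p j), Module.finrank_pi_fintype, Finset.sum_const,
    Finset.card_univ, Fintype.card_finset_len, Fintype.card_fin, smul_eq_mul]

lemma finrank_map_add_finrank_inf_ker (U : Submodule k M) [Module.Finite k U] (D : M →ₗ[k] M) :
    Module.finrank k (U.map D) + Module.finrank k (U ⊓ LinearMap.ker D : Submodule k M) =
      Module.finrank k U := by
  rw [← LinearMap.finrank_range_add_finrank_ker (D.domRestrict U), LinearMap.range_domRestrict,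
    LinearMap.ker_domRestrict]
  congr 1
  have : (LinearMap.ker D).submoduleOf U = (U ⊓ LinearMap.ker D).submoduleOf U := by
    ext x
    exact ⟨fun h => ⟨x.2, h⟩, fun h => h.2⟩
  change _ = Module.finrank k ((LinearMap.ker D).submoduleOf U)
  rw [this, LinearEquiv.finrank_eq (Submodule.submoduleOfEquivOfLe inf_le_left)]

/-- For an operator that is self-adjoint with respect to a bilinear form, its ranks on two
subspaces that the form separates can be compared. -/
lemma finrank_map_le_of_adjoint (P : M →ₗ[k] M →ₗ[k] k) (D : M →ₗ[k] M)
    (hP : ∀ v w, P (D v) w = P v (D w)) (U W : Submodule k M) [Module.Finite k W]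
    (hsep : ∀ v ∈ U.map D, (∀ w ∈ W, P v w = 0) → v = 0) :
    Module.finrank k (U.map D) ≤ Module.finrank k (W.map D) := by
  -- Pair U with D(W). Since P u (D w) = P (D u) w and W separates D(U), the kernel of L is that of
  -- D on U; so D(U) embeds in the dual of D(W).
  set L : U →ₗ[k] (W.map D →ₗ[k] k) := P.compl₁₂ U.subtype (W.map D).subtype with hL
  have hLapp : ∀ u w, L u w = P u w := fun u w => rfl
  have hker : LinearMap.ker (D.domRestrict U) = LinearMap.ker L := by
    ext u
    rw [LinearMap.mem_ker, LinearMap.mem_ker, LinearMap.domRestrict_apply]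
    constructor
    · intro h
      ext ⟨w, x, hx, rfl⟩
      rw [hLapp, ← hP, h, map_zero]
      rfl
    · intro h
      refine hsep _ (Submodule.mem_map_of_mem u.2) fun w hw => ?_
      rw [hP]
      exact LinearMap.congr_fun h ⟨D w, Submodule.mem_map_of_mem hw⟩
  rw [← LinearMap.range_domRestrict, ← LinearEquiv.finrank_eq (D.domRestrict U).quotKerEquivRange,
    LinearEquiv.finrank_eq (Submodule.quotEquivOfEq _ _ hker),
    LinearEquiv.finrank_eq L.quotKerEquivRange]
  exact (Submodule.finrank_le _).trans (Subspace.dual_finrank_eq (K := k) (V := W.map D)).le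

end PartRank

/-! ### Betti numbers in terms of ranks of differentials -/

section Rank

variable {n : ℕ} {k : Type*} [Field k] [CharZero k] {M : Type*} [AddCommGroup M]
  [Module (MvPolynomial (Fin n) k) M] [Module k M] [IsScalarTower k (MvPolynomial (Fin n) k) M]
  {𝓜 : ℤ → Submodule k M} [∀ i, Module.Finite k (𝓜 i)]

lemma koszulBetti_add_finrank (h𝓜 : IsGradedFamily n 𝓜) (p : ℕ) (j : ℤ) :
    koszulBetti n 𝓜 p j + Module.finrank k (koszulBoundaries (n := n) 𝓜 p j) =
      Module.finrank k (koszulCycles (n := n) 𝓜 p j) := by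
  have hle : koszulBoundaries (n := n) 𝓜 p j ≤ koszulCycles 𝓜 p j := by
    rintro _ ⟨η, hη, rfl⟩
    exact ⟨h𝓜.koszul_mem hη, koszul_koszul η⟩
  have : Module.Finite k (koszulCycles (n := n) 𝓜 p j) :=
    Submodule.finiteDimensional_of_le (inf_le_left : _ ≤ koszulPart 𝓜 p j)
  rw [koszulBetti, ← LinearEquiv.finrank_eq (Submodule.submoduleOfEquivOfLe hle)]
  exact Submodule.finrank_quotient_add_finrank _

lemma koszulBetti_zero_add (h𝓜 : IsGradedFamily n 𝓜) (j : ℤ) :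
    koszulBetti n 𝓜 0 j + Module.finrank k (koszulBoundaries (n := n) 𝓜 0 j) =
      Module.finrank k (𝓜 j) := by
  have h : koszulCycles (n := n) 𝓜 0 j = koszulPart 𝓜 0 j :=
    inf_eq_left.2 fun ω hω => koszul_eq_zero_of_mem_zero hω
  rw [koszulBetti_add_finrank h𝓜, h, finrank_koszulPart, Nat.choose_zero_right, one_mul,
    Nat.cast_zero, sub_zero]

/-- Rank-nullity: the dimension of the chains is the homology plus the ranks of the outgoing and the
incoming differential. -/
lemma koszulBetti_succ_add (h𝓜 : IsGradedFamily n 𝓜) (p : ℕ) (j : ℤ) :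
    koszulBetti n 𝓜 (p + 1) j + Module.finrank k (koszulBoundaries (n := n) 𝓜 p j) +
      Module.finrank k (koszulBoundaries (n := n) 𝓜 (p + 1) j) =
      n.choose (p + 1) * Module.finrank k (𝓜 (j - (p + 1 : ℕ))) := by
  rw [add_right_comm, koszulBetti_add_finrank h𝓜, ← finrank_koszulPart,
    ← finrank_map_add_finrank_inf_ker (koszulPart (n := n) 𝓜 (p + 1) j) (koszul k), add_comm]
  rfl

omit [CharZero k] in
lemma finrank_koszulBoundaries_le (p : ℕ) (j : ℤ) :
    Module.finrank k (koszulBoundaries (n := n) 𝓜 p j) ≤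
      n.choose (p + 1) * Module.finrank k (𝓜 (j - (p + 1 : ℕ))) := by
  rw [← finrank_koszulPart]
  exact Submodule.finrank_map_le _ _

end Rank

/-! ### Self-duality of the Koszul complex of a Gorenstein algebra -/

section Duality

variable {n : ℕ}

/-- The sign that makes the Koszul differential self-adjoint. -/
def dualSign (T : Finset (Fin n)) : ℤ := ∏ b ∈ T, koszulSign b Finset.univ

lemma dualSign_mul_self (T : Finset (Fin n)) : dualSign T * dualSign T = 1 := by
  rw [dualSign, ← Finset.prod_mul_distrib]
  exact Finset.prod_eq_one fun b _ => koszulSign_mul_self b _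

/-- The sign of b against all indices splits into its signs against T ∪ {b} and the complement, with
b itself contributing 1. -/
lemma dualSign_mul_koszulSign {b : Fin n} {T : Finset (Fin n)} (hb : b ∉ T) :
    dualSign T * koszulSign b T = dualSign (insert b T) * koszulSign b (insert b T)ᶜ := by
  have h1 : koszulSign b (insert b T) * koszulSign b (insert b T)ᶜ = koszulSign b Finset.univ :=
    Finset.prod_mul_prod_compl _ _
  rw [koszulSign_insert hb, if_neg (lt_irrefl b), one_mul] at h1
  have h2 : dualSign (insert b T) = koszulSign b Finset.univ * dualSign T := Finset.prod_insert hb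
  rw [h2, ← h1]
  linear_combination (-(dualSign T * koszulSign b T)) * koszulSign_mul_self b (insert b T)ᶜ

variable {k : Type*} [Field k] {A : Type*} [CommRing A] [Algebra k A]

/-- The pairing on the Koszul complex of `A` induced by a functional on `A`. -/
def koszulPairing (n : ℕ) (φ : A →ₗ[k] k) :
    (Finset (Fin n) → A) →ₗ[k] (Finset (Fin n) → A) →ₗ[k] k :=
  LinearMap.mk₂ k (fun ω η => ∑ T, dualSign T • φ (ω T * η Tᶜ))
    (fun ω ω' η => by simp [add_mul, Finset.sum_add_distrib])
    (fun c ω η => by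
      simp only [Pi.smul_apply, smul_mul_assoc, map_smul, Finset.smul_sum]
      exact Finset.sum_congr rfl fun T _ => smul_comm _ _ _)
    (fun ω η η' => by simp [mul_add, Finset.sum_add_distrib])
    (fun c ω η => by
      simp only [Pi.smul_apply, mul_smul_comm, map_smul, Finset.smul_sum]
      exact Finset.sum_congr rfl fun T _ => smul_comm _ _ _)

lemma koszulPairing_apply (φ : A →ₗ[k] k) (ω η : Finset (Fin n) → A) :
    koszulPairing n φ ω η = ∑ T, dualSign T • φ (ω T * η Tᶜ) := rfl

variable [Algebra (MvPolynomial (Fin n) k) A] [IsScalarTower k (MvPolynomial (Fin n) k) A]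

/-- For each b, inserting b matches the sets omitting b, which index the left-hand terms, with those
containing b, which index the right-hand terms; `dualSign` reconciles the signs. -/
lemma koszulPairing_koszul (φ : A →ₗ[k] k) (ω η : Finset (Fin n) → A) :
    koszulPairing n φ (koszul k ω) η = koszulPairing n φ ω (koszul k η) := by
  have h1 : koszulPairing n φ (koszul k ω) η = ∑ b, ∑ T with b ∉ T,
      (dualSign T * koszulSign b T) •
        φ ((X b : MvPolynomial (Fin n) k) • (ω (insert b T) * η Tᶜ)) := by
    rw [koszulPairing_apply]
    simp only [Finset.sum_filter]
    rw [Finset.sum_comm]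
    refine Finset.sum_congr rfl fun T _ => ?_
    rw [koszul_apply, Finset.sum_mul, map_sum, Finset.smul_sum]
    refine Finset.sum_congr rfl fun b _ => ?_
    by_cases hb : b ∈ T
    · simp [hb]
    · rw [if_neg hb, if_pos hb, smul_mul_assoc, map_zsmul, smul_smul, smul_mul_assoc]
  have h2 : koszulPairing n φ ω (koszul k η) = ∑ b, ∑ T with b ∈ T,
      (dualSign T * koszulSign b Tᶜ) •
        φ ((X b : MvPolynomial (Fin n) k) • (ω T * η (insert b Tᶜ))) := by
    rw [koszulPairing_apply]
    simp only [Finset.sum_filter]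
    rw [Finset.sum_comm]
    refine Finset.sum_congr rfl fun T _ => ?_
    rw [koszul_apply, Finset.mul_sum, map_sum, Finset.smul_sum]
    refine Finset.sum_congr rfl fun b _ => ?_
    by_cases hb : b ∈ T
    · rw [if_neg (by simpa using hb), if_pos hb, mul_smul_comm, map_zsmul, smul_smul,
        mul_smul_comm]
    · simp [hb]
  rw [h1, h2]
  refine Finset.sum_congr rfl fun b _ => ?_
  refine Finset.sum_nbij' (fun T => insert b T) (fun T => T.erase b) ?_ ?_ ?_ ?_ ?_
  · simp
  · simp
  · intro T hT
    exact Finset.erase_insert (by simpa using hT)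
  · intro T hT
    exact Finset.insert_erase (by simpa using hT)
  · intro T hT
    have hb : b ∉ T := by simpa using hT
    have h : insert b (insert b T)ᶜ = Tᶜ := by
      ext c
      by_cases hc : c = b
      · simp [hc, hb]
      · simp [hc]
    rw [h, dualSign_mul_koszulSign hb]

variable {𝓐 : ℤ → Submodule k A}

/-- A test chain supported on the complement of T isolates φ(ω T * b); the degrees fit because (j -
p) + (j' - q) = s. -/
lemma koszulPairing_separating {φ : A →ₗ[k] k} {s : ℤ}
    (hφ : ∀ i, ∀ a ∈ 𝓐 i, (∀ b ∈ 𝓐 (s - i), φ (a * b) = 0) → a = 0)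
    {p q : ℕ} (hpq : p + q = n) {j j' : ℤ} (hj : j + j' = n + s) {ω : Finset (Fin n) → A}
    (hω : ω ∈ koszulPart 𝓐 p j) (h : ∀ η ∈ koszulPart 𝓐 q j', koszulPairing n φ ω η = 0) :
    ω = 0 := by
  ext1 T
  by_cases hT : T.card = p
  swap
  · exact (hω T).2 hT
  refine hφ _ _ ((hω T).1 hT) fun b hb => ?_
  have hTc : Tᶜ.card = q := by
    rw [Finset.card_compl, Fintype.card_fin]
    omega
  have hη : Pi.single Tᶜ b ∈ koszulPart 𝓐 q j' := by
    intro U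
    rcases eq_or_ne U Tᶜ with rfl | hU
    · refine ⟨fun _ => ?_, fun hU => absurd hTc hU⟩
      rw [Pi.single_eq_same]
      convert hb using 2
      omega
    · rw [Pi.single_eq_of_ne hU]
      exact ⟨fun _ => zero_mem _, fun _ => rfl⟩
  have := h _ hη
  rw [koszulPairing_apply, Finset.sum_eq_single T, Pi.single_eq_same] at this
  · rw [← one_smul ℤ (φ _), ← dualSign_mul_self T, mul_smul, this, smul_zero]
  · intro U _ hU
    rw [Pi.single_eq_of_ne (by simpa using hU), mul_zero, map_zero, smul_zero]
  · simp

/-- The Koszul differentials of a graded Gorenstein algebra have symmetric ranks. -/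
lemma finrank_koszulBoundaries_symm [∀ i, Module.Finite k (𝓐 i)] {φ : A →ₗ[k] k} {s : ℤ}
    (h𝓐 : IsGradedFamily n 𝓐)
    (hφ : ∀ i, ∀ a ∈ 𝓐 i, (∀ b ∈ 𝓐 (s - i), φ (a * b) = 0) → a = 0)
    {p q : ℕ} (hpq : p + q + 1 = n) {j j' : ℤ} (hj : j + j' = n + s) :
    Module.finrank k (koszulBoundaries (n := n) 𝓐 p j) =
      Module.finrank k (koszulBoundaries (n := n) 𝓐 q j') := by
  have key : ∀ {p q : ℕ} {j j' : ℤ}, p + q + 1 = n → j + j' = n + s →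
      Module.finrank k (koszulBoundaries (n := n) 𝓐 p j) ≤
      Module.finrank k (koszulBoundaries (n := n) 𝓐 q j') := by
    intro p q j j' hpq hj
    refine finrank_map_le_of_adjoint (koszulPairing n φ) (koszul k) (koszulPairing_koszul φ) _ _ ?_
    rintro _ ⟨ω, hω, rfl⟩ h
    -- Boundaries lie in homological degree p, dual to n - p = q + 1, the source of the other
    -- differential.
    exact koszulPairing_separating hφ (p := p) (q := q + 1) (by omega) hj (h𝓐.koszul_mem hω) h
  exact le_antisymm (key hpq hj) (key (by omega) (by omega))

end Duality

/-! ### The apolar algebra -/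

section Apolar

variable {n : ℕ} {k : Type*} [Field k]

lemma mem_perp {f g : MvPolynomial (Fin n) k} : f ∈ perp g ↔ action (Fin n) k f g = 0 := Iff.rfl

lemma action_C (c : k) (h : MvPolynomial (Fin n) k) : action (Fin n) k (C c) h = c • h := by
  rw [← MvPolynomial.algebraMap_eq, AlgHom.commutes]
  rfl

lemma action_mul (f f' h : MvPolynomial (Fin n) k) :
    action (Fin n) k (f * f') h = action (Fin n) k f (action (Fin n) k f' h) := by
  rw [map_mul]
  rfl

lemma action_X_apply (b : Fin n) (h : MvPolynomial (Fin n) k) :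
    action (Fin n) k (X b) h = pderiv b h := by
  rw [action_X]
  rfl

lemma action_monomial_mem (γ : Fin n →₀ ℕ) : ∀ (c : k) {e : ℤ} {h : MvPolynomial (Fin n) k},
    h ∈ formPart n k e → action (Fin n) k (monomial γ c) h ∈ formPart n k (e - γ.degree) := by
  induction γ using Finsupp.induction_linear with
  | zero =>
    intro c e h hh
    have h0 : (monomial 0 c : MvPolynomial (Fin n) k) = C c := rfl
    rw [h0, action_C]
    simpa using Submodule.smul_mem _ c hh
  | add γ γ' ih ih' =>
    intro c e h hh
    have : (monomial (γ + γ') c : MvPolynomial (Fin n) k) = monomial γ c * monomial γ' 1 := by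
      rw [monomial_mul, mul_one]
    rw [this, action_mul]
    have := ih c (ih' 1 hh)
    rwa [sub_sub, ← Nat.cast_add, add_comm γ'.degree, ← map_add] at this
  | single b a =>
    intro c e h hh
    have : (monomial (Finsupp.single b a) c : MvPolynomial (Fin n) k) = C c * X b ^ a := by
      rw [X_pow_eq_monomial, C_mul_monomial, mul_one]
    rw [this, action_mul, action_C, Finsupp.degree_single]
    refine Submodule.smul_mem _ _ ?_
    clear this
    induction a with
    | zero => simpa using hh
    | succ a ih =>
      rw [pow_succ', action_mul, action_X_apply]
      have := pderiv_mem_formPart b ih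
      rwa [sub_sub] at this

lemma formProj_eq_zero {l m : ℤ} (hlm : l ≠ m) {f : MvPolynomial (Fin n) k}
    (hf : f ∈ formPart n k l) : formProj n k m f = 0 := by
  ext γ
  rw [coeff_formProj, coeff_zero]
  split_ifs with h
  · by_contra h'
    exact hlm ((hf γ h').symm.trans h)
  · rfl

lemma formProj_action {e : ℤ} {g : MvPolynomial (Fin n) k} (hg : g ∈ formPart n k e) (m : ℤ)
    (f : MvPolynomial (Fin n) k) :
    formProj n k (e - m) (action (Fin n) k f g) = action (Fin n) k (formProj n k m f) g := by
  induction f using MvPolynomial.induction_on' with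
  | monomial γ c =>
    have h1 : (monomial γ c : MvPolynomial (Fin n) k) ∈ formPart n k γ.degree :=
      mem_formPart_natCast.2 (isHomogeneous_monomial c rfl)
    have h2 := action_monomial_mem γ c hg
    by_cases h : (γ.degree : ℤ) = m
    · rw [← h, formProj_eq_self h1, formProj_eq_self h2]
    · rw [formProj_eq_zero h h1, formProj_eq_zero (by omega) h2, map_zero]
      rfl
  | add p q hp hq => simp only [map_add, LinearMap.add_apply, hp, hq]

lemma action_mem_formPart {e m : ℤ} {f g : MvPolynomial (Fin n) k} (hf : f ∈ formPart n k m)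
    (hg : g ∈ formPart n k e) : action (Fin n) k f g ∈ formPart n k (e - m) := by
  rw [← formProj_eq_self hf, ← formProj_action hg]
  exact formProj_mem _ _

lemma formProj_mem_perp {e : ℤ} {g : MvPolynomial (Fin n) k} (hg : g ∈ formPart n k e) (m : ℤ)
    (f : MvPolynomial (Fin n) k) (hf : f ∈ perp g) : formProj n k m f ∈ perp g := by
  rw [mem_perp] at hf ⊢
  rw [← formProj_action hg, hf, map_zero]

/-- A nonzero form is detected by differential operators of the same degree. -/
lemma exists_constantCoeff_action_ne_zero [CharZero k] (e : ℕ) :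
    ∀ {q : MvPolynomial (Fin n) k}, q ∈ formPart n k e → q ≠ 0 →
      ∃ f ∈ formPart n k e, constantCoeff (action (Fin n) k f q) ≠ 0 := by
  induction e with
  | zero =>
    intro q hq hq0
    refine ⟨C 1, C_mem_formPart 1, fun h => hq0 ?_⟩
    rw [action_C, one_smul] at h
    rw [eq_C_of_mem_formPart_zero hq, h, C_0]
  | succ e ih =>
    intro q hq hq0
    obtain ⟨b, hb⟩ : ∃ b, pderiv b q ≠ 0 := by
      -- If all partial derivatives vanished, Euler's formula would give (e + 1) q = 0.
      by_contra! h
      have := sum_X_mul_pderiv_of_mem_formPart hq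
      simp only [h, mul_zero, Finset.sum_const_zero] at this
      exact hq0 ((smul_eq_zero.1 this.symm).resolve_left (Int.cast_ne_zero.2 (by positivity)))
    have hbq := pderiv_mem_formPart b hq
    rw [Nat.cast_succ, add_sub_cancel_right] at hbq
    obtain ⟨f, hf, hf'⟩ := ih hbq hb
    refine ⟨f * X b, by rw [Nat.cast_succ]; exact mul_mem_formPart hf (X_mem_formPart b), ?_⟩
    rwa [action_mul, action_X_apply]

/-- The functional `f ↦ f(g)(0)` on `S/g^⊥`. -/
def apolarFunctional (g : MvPolynomial (Fin n) k) : (MvPolynomial (Fin n) k ⧸ perp g) →ₗ[k] k :=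
  (((perp g).restrictScalars k).liftQ
    (lcoeff k (0 : Fin n →₀ ℕ) ∘ₗ LinearMap.applyₗ g ∘ₗ (action (Fin n) k).toLinearMap)
    (fun f hf => by
      have h : action (Fin n) k f g = 0 := hf
      simp [h])) ∘ₗ (Submodule.Quotient.restrictScalarsEquiv k (perp g)).symm.toLinearMap

lemma apolarFunctional_mk (g f : MvPolynomial (Fin n) k) :
    apolarFunctional g (Ideal.Quotient.mk (perp g) f) = constantCoeff (action (Fin n) k f g) := rfl

lemma mem_quotPart {I : Ideal (MvPolynomial (Fin n) k)} {j : ℤ}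
    {x : MvPolynomial (Fin n) k ⧸ I} :
    x ∈ quotPart I j ↔ ∃ f ∈ formPart n k j, Ideal.Quotient.mk I f = x := Iff.rfl

/-- Macaulay duality: if f(g) ≠ 0, it is a form of degree e - i, and some f' of that degree sends it
to a nonzero constant, which is the value of the functional on f f'. -/
lemma apolarFunctional_nondegenerate [CharZero k] {e : ℤ} {g : MvPolynomial (Fin n) k}
    (hg : g ∈ formPart n k e) (i : ℤ) (a : MvPolynomial (Fin n) k ⧸ perp g)
    (ha : a ∈ quotPart (perp g) i)
    (h : ∀ b ∈ quotPart (perp g) (e - i), apolarFunctional g (a * b) = 0) : a = 0 := by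
  obtain ⟨f, hf, rfl⟩ := mem_quotPart.1 ha
  rw [Ideal.Quotient.eq_zero_iff_mem, mem_perp]
  by_contra hne
  have hq := action_mem_formPart hf hg
  rcases lt_or_ge (e - i) 0 with hneg | hpos
  · rw [formPart_of_neg hneg, Submodule.mem_bot] at hq
    exact hne hq
  obtain ⟨m, hm⟩ := Int.eq_ofNat_of_zero_le hpos
  rw [hm] at hq
  obtain ⟨f', hf', hne'⟩ := exists_constantCoeff_action_ne_zero m hq hne
  refine hne' ?_
  have := h _ (mem_quotPart.2 ⟨f', by rwa [hm], rfl⟩)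
  rwa [← map_mul, apolarFunctional_mk, mul_comm, action_mul] at this

lemma isGradedFamily_formPart : IsGradedFamily n (formPart n k) := fun b j f hf => by
  rw [add_comm]
  exact mul_mem_formPart (X_mem_formPart b) hf

lemma isGradedFamily_quotPart (I : Ideal (MvPolynomial (Fin n) k)) :
    IsGradedFamily n (quotPart I) := by
  rintro b j _ ⟨f, hf, rfl⟩
  exact ⟨_, isGradedFamily_formPart b j f hf, rfl⟩

instance finite_formPart (j : ℤ) : Module.Finite k (formPart n k j) := by
  rcases lt_or_ge j 0 with hj | hj
  · rw [formPart_of_neg hj]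
    infer_instance
  · lift j to ℕ using hj
    rw [formPart_natCast]
    exact Module.Finite.iff_fg.2 (homogeneousSubmodule_fg _ _ _)

instance finite_quotPart (I : Ideal (MvPolynomial (Fin n) k)) (j : ℤ) :
    Module.Finite k (quotPart I j) :=
  Module.Finite.map _ _

lemma finrank_quotPart_natCast (I : Ideal (MvPolynomial (Fin n) k)) (i : ℕ) :
    Module.finrank k (quotPart I i) = hilbertFunction I i := by
  rw [quotPart, formPart_natCast]
  rfl

lemma finrank_quotPart_of_neg (I : Ideal (MvPolynomial (Fin n) k)) {j : ℤ} (hj : j < 0) :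
    Module.finrank k (quotPart I j) = 0 := by
  rw [quotPart, formPart_of_neg hj, Submodule.map_bot, finrank_bot]

lemma koszulCycles_formPart_le [CharZero k] (p : ℕ) {j : ℤ} (hj : j ≠ 0) :
    koszulCycles (n := n) (formPart n k) p j ≤ koszulBoundaries (formPart n k) p j := by
  intro ω hω
  refine ⟨(j : k)⁻¹ • deRham ω, Submodule.smul_mem _ _ (deRham_mem hω.1), ?_⟩
  rw [map_smul, koszul_deRham_of_cycle hω.1 hω.2, smul_smul,
    inv_mul_cancel₀ (Int.cast_ne_zero.2 hj), one_smul]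

/-- S/I is generated by the class of 1, so every element of degree j ≠ 0 is a combination of
multiples of the variables; lifting to S reduces this to the homotopy. -/
lemma finrank_koszulBoundaries_quotPart_zero [CharZero k] (I : Ideal (MvPolynomial (Fin n) k))
    {j : ℤ} (hj : j ≠ 0) :
    Module.finrank k (koszulBoundaries (n := n) (quotPart I) 0 j) =
      Module.finrank k (quotPart I j) := by
  have h : koszulBoundaries (n := n) (quotPart I) 0 j = koszulPart (quotPart I) 0 j := by
    refine le_antisymm ?_ ?_
    · rintro _ ⟨ω, hω, rfl⟩
      exact (isGradedFamily_quotPart I).koszul_mem hω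
    · intro ω hω
      obtain ⟨η, hη, rfl⟩ := exists_koszulPart_lift _ _ _ _ hω
      obtain ⟨θ, hθ, rfl⟩ := koszulCycles_formPart_le 0 hj ⟨hη, koszul_eq_zero_of_mem_zero hη⟩
      exact ⟨_, map_mem_koszulPart (Ideal.Quotient.mkₐ k I).toLinearMap hθ,
        koszul_map I.mkQ θ⟩
  rw [h, finrank_koszulPart, Nat.choose_zero_right, one_mul, Nat.cast_zero, sub_zero]

/-- If `I` contains no linear forms, the first strand of the Koszul complex of `S/I` is as
injective as that of `S`. -/
lemma finrank_koszulBoundaries_linear {I : Ideal (MvPolynomial (Fin n) k)}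
    (h0 : Module.finrank k (quotPart I 0) = 1) (h1 : Module.finrank k (quotPart I 1) = n) (p : ℕ) :
    Module.finrank k (koszulBoundaries (n := n) (quotPart I) p (p + 1 : ℕ)) =
      n.choose (p + 1) := by
  have hspan : quotPart I 1 = Submodule.span k
      (Set.range fun b : Fin n => Ideal.Quotient.mk I (X b)) := by
    have : formPart n k 1 = homogeneousSubmodule (Fin n) k 1 := formPart_natCast 1
    rw [quotPart, this, homogeneousSubmodule_one_eq_span_X, Submodule.map_span, ← Set.range_comp]
    rfl
  have hli : LinearIndependent k fun b : Fin n => Ideal.Quotient.mk I (X b) := by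
    rw [linearIndependent_iff_card_eq_finrank_span, Set.finrank, ← hspan, h1, Fintype.card_fin]
  have hinj : koszulPart (n := n) (quotPart I) (p + 1) (p + 1 : ℕ) ⊓ LinearMap.ker (koszul k) =
      ⊥ := by
    refine (Submodule.eq_bot_iff _).2 fun ω hω => ?_
    have hω0 : koszul k ω = 0 := hω.2
    have hc : ∀ T, ∃ c : k, c • Ideal.Quotient.mk I 1 = ω T := by
      intro T
      by_cases hT : T.card = p + 1
      · obtain ⟨f, hf, hfT⟩ := mem_quotPart.1 ((hω.1 T).1 hT)
        rw [sub_self] at hf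
        refine ⟨constantCoeff f, ?_⟩
        rw [← hfT, eq_C_of_mem_formPart_zero hf, constantCoeff_C, ← mul_one (C _), ← smul_eq_C_mul]
        rfl
      · exact ⟨0, by rw [(hω.1 T).2 hT, zero_smul]⟩
    choose c hc using hc
    ext1 U
    by_cases hU : U.card = p + 1
    swap
    · exact (hω.1 U).2 hU
    obtain ⟨b, hb⟩ : U.Nonempty := Finset.card_pos.1 (by omega)
    -- At U \ {b} the coefficient of x_b in the differential is ±c U, and the classes of the
    -- variables are independent.
    have h2 := congrFun hω0 (U.erase b)
    rw [koszul_apply] at h2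
    have h3 : ∑ a, (if a ∈ U.erase b then (0 : k) else
        (koszulSign a (U.erase b) : k) * c (insert a (U.erase b))) •
          Ideal.Quotient.mk I (X a) = 0 := by
      refine Eq.trans ?_ h2
      refine Finset.sum_congr rfl fun a _ => ?_
      split_ifs
      · exact zero_smul _ _
      · rw [← hc, mul_smul, Int.cast_smul_eq_zsmul]
        congr 1
        rw [smul_comm]
        congr 1
        change _ = Ideal.Quotient.mk I ((X a : MvPolynomial (Fin n) k) • 1)
        rw [smul_eq_mul, mul_one]
    have h4 := Fintype.linearIndependent_iff.1 hli _ h3 b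
    rw [if_neg (Finset.notMem_erase _ _), Finset.insert_erase hb] at h4
    have h5 : (koszulSign b (U.erase b) : k) ≠ 0 := fun h => by
      have := congrArg (Int.cast : ℤ → k) (koszulSign_mul_self b (U.erase b))
      rw [Int.cast_mul, h, zero_mul, Int.cast_one] at this
      exact zero_ne_one this
    rw [← hc, (mul_eq_zero.1 h4).resolve_left h5, zero_smul]
    rfl
  have := finrank_map_add_finrank_inf_ker (koszulPart (n := n) (quotPart I) (p + 1) (p + 1 : ℕ))
    (koszul k)
  rw [hinj, finrank_bot, add_zero, finrank_koszulPart, sub_self, h0, mul_one] at this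
  exact this

/-- An ideal whose quotient has no Koszul homology in bidegree `(1, d)` has no minimal generators
of degree `d`. -/
lemma mem_idealOfVars_mul_of_koszulBetti_eq_zero [CharZero k] {I : Ideal (MvPolynomial (Fin n) k)}
    {d : ℕ} (hd : d ≠ 0) (h : koszulBetti n (quotPart I) 1 d = 0) {f : MvPolynomial (Fin n) k}
    (hf : f ∈ I) (hfd : f ∈ formPart n k d) : f ∈ idealOfVars (Fin n) k * I := by
  have hd' : (d : ℤ) ≠ 0 := Nat.cast_ne_zero.2 hd
  set 𝓘 : ℤ → Submodule k (MvPolynomial (Fin n) k) :=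
    fun i => formPart n k i ⊓ LinearMap.ker (I.mkQ.restrictScalars k) with h𝓘
  have hker : ∀ x, I.mkQ.restrictScalars k x = 0 ↔ x ∈ I :=
    fun x => Submodule.Quotient.mk_eq_zero I
  -- Shifting along I → S → S/I turns first homology of S/I into zeroth homology of I, that is,
  -- (I/𝔪I)_d.
  have hshift : koszulBetti n (quotPart I) 1 d = koszulBetti n 𝓘 0 d :=
    koszulBetti_map_eq_ker isGradedFamily_formPart I.mkQ 0 d (koszulCycles_formPart_le _ hd')
      fun ω hω => koszulCycles_formPart_le 0 hd'
        ⟨koszulPart_mono (fun _ => inf_le_left) hω.1, hω.2⟩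
  rw [hshift, koszulBetti] at h
  have hfin : ∀ i, Module.Finite k (𝓘 i) := fun i =>
    Submodule.finiteDimensional_of_le (inf_le_left : _ ≤ formPart n k i)
  have : Module.Finite k (koszulCycles (n := n) 𝓘 0 d) :=
    Submodule.finiteDimensional_of_le (inf_le_left : _ ≤ koszulPart 𝓘 0 d)
  have hsub := Submodule.Quotient.subsingleton_iff.1 (Module.finrank_zero_iff.1 h)
  have hω : Pi.single ∅ f ∈ koszulPart (n := n) 𝓘 0 d := by
    intro T
    rw [Finset.card_eq_zero]
    refine ⟨fun hT => ?_, fun hT => Pi.single_eq_of_ne (fun h => hT (by rw [h]; rfl)) _⟩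
    rw [hT, Pi.single_eq_same, Nat.cast_zero, sub_zero]
    exact ⟨hfd, (hker f).2 hf⟩
  have hmem : (⟨Pi.single ∅ f, hω, koszul_eq_zero_of_mem_zero hω⟩ :
      koszulCycles (n := n) 𝓘 0 d) ∈
      (koszulBoundaries 𝓘 0 d).submoduleOf (koszulCycles 𝓘 0 d) := by
    rw [hsub]
    exact Submodule.mem_top
  obtain ⟨η, hη, hηf⟩ := hmem
  have h1 := congrFun hηf ∅
  have h2 : f = koszul k η ∅ := by
    rw [h1]
    change f = (Pi.single ∅ f : Finset (Fin n) → MvPolynomial (Fin n) k) ∅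
    rw [Pi.single_eq_same]
  rw [h2, koszul_apply]
  refine Submodule.sum_mem _ fun b _ => ?_
  split_ifs
  · exact zero_mem _
  · have hX : (X b : MvPolynomial (Fin n) k) ∈ idealOfVars (Fin n) k :=
      Ideal.subset_span ⟨b, rfl⟩
    refine zsmul_mem (Ideal.mul_mem_mul hX ?_) _
    exact (hker _).1 (((koszulPart_inf_ker _ _ _ _ _).1 hη).2 _)

end Apolar

/-! ### The Betti table of a cubic with Hilbert function `(1, 4, 4, 1)` -/

section Cubic

variable {k : Type*} [Field k] {g : MvPolynomial (Fin 4) k}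

lemma koszulBetti_of_lt [CharZero k] {n p : ℕ} (hp : n < p) (I : Ideal (MvPolynomial (Fin n) k)) (j : ℤ) :
    koszulBetti n (quotPart I) p j = 0 := by
  have h : koszulPart (n := n) (quotPart I) p j = ⊥ := koszulPart_of_lt _ hp j
  have h1 := koszulBetti_add_finrank (isGradedFamily_quotPart I) p j
  rw [koszulCycles, h, bot_inf_eq, finrank_bot] at h1
  omega

/-- The dimensions of the graded pieces of `S/g^⊥`, as a function of an integral degree. -/
lemma finrank_quotPart_perp
    (hA : ∀ i : ℕ, hilbertFunction (perp g) i = [1, 4, 4, 1].getD i 0) (j : ℤ) :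
    Module.finrank k (quotPart (perp g) j) =
      if j = 0 then 1 else if j = 1 then 4 else if j = 2 then 4 else if j = 3 then 1 else 0 := by
  rcases lt_or_ge j 0 with hj | hj
  · rw [finrank_quotPart_of_neg _ hj]
    split_ifs <;> omega
  · lift j to ℕ using hj
    rw [finrank_quotPart_natCast, hA]
    match j with
    | 0 => rfl
    | 1 => rfl
    | 2 => rfl
    | 3 => rfl
    | j + 4 =>
      rw [List.getD_eq_default _ _ (by simp)]
      split_ifs <;> omega

lemma koszulBetti_perp [CharZero k] (hg : g.IsHomogeneous 3)
    (hA : ∀ i : ℕ, hilbertFunction (perp g) i = [1, 4, 4, 1].getD i 0) :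
    ∃ β : ℕ, ∀ j : ℤ,
      koszulBetti 4 (quotPart (perp g)) 0 j = (if j = 0 then 1 else 0) ∧
      koszulBetti 4 (quotPart (perp g)) 1 j = (if j = 3 then β else 0) + (if j = 2 then 6 else 0) ∧
      koszulBetti 4 (quotPart (perp g)) 2 j =
        (if j = 4 then 5 + β else 0) + (if j = 3 then 5 + β else 0) ∧
      koszulBetti 4 (quotPart (perp g)) 3 j = (if j = 5 then 6 else 0) + (if j = 4 then β else 0) ∧
      koszulBetti 4 (quotPart (perp g)) 4 j = (if j = 7 then 1 else 0) := by
  have hg' : g ∈ formPart 4 k 3 := mem_formPart_natCast.2 hg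
  have hfam := isGradedFamily_quotPart (perp g)
  have hH := finrank_quotPart_perp hA
  have hlin := fun p => finrank_koszulBoundaries_linear (I := perp g) (by rw [hH]; rfl)
    (by rw [hH]; rfl) p
  have hsymm : ∀ {p q : ℕ} {j j' : ℤ}, p + q + 1 = 4 → j + j' = 7 →
      Module.finrank k (koszulBoundaries (n := 4) (quotPart (perp g)) p j) =
        Module.finrank k (koszulBoundaries (n := 4) (quotPart (perp g)) q j') := fun hpq hj =>
    finrank_koszulBoundaries_symm hfam (apolarFunctional_nondegenerate hg') hpq
      (by rw [hj]; norm_num)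
  have hsurj := fun (j : ℤ) (hj : j ≠ 0) => finrank_koszulBoundaries_quotPart_zero (perp g) hj
  have hle := fun p j => finrank_koszulBoundaries_le (n := 4) (𝓜 := quotPart (perp g)) p j
  have hb0 := fun j => koszulBetti_zero_add (n := 4) hfam j
  have hbs := fun p j => koszulBetti_succ_add (n := 4) hfam p j
  -- From here only arithmetic remains: the Betti numbers and the ranks R p j are natural numbers
  -- tied by the relations above.
  generalize koszulBetti 4 (quotPart (perp g)) = b at *
  set R : ℕ → ℤ → ℕ := fun p j =>
    Module.finrank k (koszulBoundaries (n := 4) (quotPart (perp g)) p j) with hR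
  simp only [hH] at hsurj hle hb0 hbs
  have c1 : Nat.choose 4 1 = 4 := rfl
  have c2 : Nat.choose 4 2 = 6 := rfl
  have c3 : Nat.choose 4 3 = 4 := rfl
  have c4 : Nat.choose 4 4 = 1 := rfl
  have c5 : Nat.choose 4 5 = 0 := rfl
  have r01 : R 0 1 = 4 := hlin 0
  have r12 : R 1 2 = 6 := hlin 1
  have r23 : R 2 3 = 4 := hlin 2
  have r34 : R 3 4 = 1 := hlin 3
  have r02 : R 0 2 = 4 := hsurj 2 (by norm_num)
  have r36 : R 3 6 = 4 := (hsymm (by norm_num) (by norm_num)).trans r01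
  have r25 : R 2 5 = 6 := (hsymm (by norm_num) (by norm_num)).trans r12
  have r14 : R 1 4 = 4 := (hsymm (by norm_num) (by norm_num)).trans r23
  have r03 : R 0 3 = 1 := (hsymm (by norm_num) (by norm_num)).trans r34
  have r35 : R 3 5 = 4 := (hsymm (by norm_num) (by norm_num)).trans r02
  -- The one dual pair of ranks that the three facts leave undetermined. The relation `hβ` below
  -- reads b 1 3 + 1 + R 1 3 = 4 · 4, so β = b 1 3 = 15 - R 1 3.
  have r24 : R 2 4 = R 1 3 := hsymm (by norm_num) (by norm_num)
  have hβ := hbs 0 3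
  change b 1 3 + R 0 3 + R 1 3 = _ at hβ
  norm_num at hβ
  refine ⟨b 1 3, fun j => ?_⟩
  have e0 : b 0 j + R 0 j = _ := hb0 j
  have e1 : b 1 j + R 0 j + R 1 j = _ := hbs 0 j
  have e2 : b 2 j + R 1 j + R 2 j = _ := hbs 1 j
  have e3 : b 3 j + R 2 j + R 3 j = _ := hbs 2 j
  have e4 : b 4 j + R 3 j + R 4 j = _ := hbs 3 j
  have l4 : R 4 j ≤ _ := hle 4 j
  have l3 : R 3 j ≤ _ := hle 3 j
  have l2 : R 2 j ≤ _ := hle 2 j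
  have l1 : R 1 j ≤ _ := hle 1 j
  have l0 : R 0 j ≤ _ := hle 0 j
  clear_value R
  clear hsymm hsurj hle hb0 hbs hlin hH hfam
  simp only [zero_add, Nat.reduceAdd, c1, c2, c3, c4, c5, Nat.cast_ofNat, Nat.cast_one]
    at e0 e1 e2 e3 e4 l0 l1 l2 l3 l4 ⊢
  by_cases hj : 0 ≤ j ∧ j ≤ 7
  · obtain ⟨hj0, hj7⟩ := hj
    interval_cases j <;> norm_num at e0 e1 e2 e3 e4 l0 l1 l2 l3 l4 ⊢ <;> omega
  -- Chains need 0 ≤ p ≤ 4 and 0 ≤ j - p ≤ 3, so there are none outside 0 ≤ j ≤ 7.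
  · have hz : ∀ m : ℤ, m < 0 ∨ 3 < m → (if m = 0 then 1 else if m = 1 then 4 else
        if m = 2 then 4 else if m = 3 then 1 else 0) = 0 := by
      intro m hm
      split_ifs <;> omega
    rw [hz _ (by omega)] at e0 e1 e2 e3 e4
    rw [if_neg (by omega), if_neg (by omega), if_neg (by omega), if_neg (by omega),
      if_neg (by omega), if_neg (by omega), if_neg (by omega), if_neg (by omega)]
    omega

lemma hasShape_of_isMinimal [CharZero k] (hg : g.IsHomogeneous 3)
    {β : ℕ} (hβ : ∀ j : ℤ,
      koszulBetti 4 (quotPart (perp g)) 0 j = (if j = 0 then 1 else 0) ∧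
      koszulBetti 4 (quotPart (perp g)) 1 j = (if j = 3 then β else 0) + (if j = 2 then 6 else 0) ∧
      koszulBetti 4 (quotPart (perp g)) 2 j =
        (if j = 4 then 5 + β else 0) + (if j = 3 then 5 + β else 0) ∧
      koszulBetti 4 (quotPart (perp g)) 3 j = (if j = 5 then 6 else 0) + (if j = 4 then β else 0) ∧
      koszulBetti 4 (quotPart (perp g)) 4 j = (if j = 7 then 1 else 0))
    (F : GradedFreeResolution (perp g)) (hF : F.IsMinimal) : F.HasShape β := by
  have hcount : ∀ i j, (F.twists i).count j = koszulBetti 4 (quotPart (perp g)) i j := by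
    intro i j
    rw [F.count_twists, F.card_deg_eq_koszulBetti hF
      (fun m f hf => formProj_mem_perp (mem_formPart_natCast.2 hg) m f hf)]
  refine ⟨?_, ?_, ?_, ?_, ?_, fun i hi => ?_⟩ <;> ext j <;> rw [hcount]
  · rw [(hβ j).1, Multiset.count_singleton]
  · rw [(hβ j).2.1, Multiset.count_add, Multiset.count_replicate, Multiset.count_replicate]
    simp only [eq_comm]
  · rw [(hβ j).2.2.1, Multiset.count_add, Multiset.count_replicate, Multiset.count_replicate]
    simp only [eq_comm]
  · rw [(hβ j).2.2.2.1, Multiset.count_add, Multiset.count_replicate, Multiset.count_replicate]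
    simp only [eq_comm]
  · rw [(hβ j).2.2.2.2, Multiset.count_singleton]
  · rw [koszulBetti_of_lt (by omega), Multiset.count_zero]

/-- Otherwise the homogeneous ideal g^⊥ would contain a nonzero constant, the degree-0 component of
f, and the quotient would be zero. -/
lemma perp_le_idealOfVars (hg : g.IsHomogeneous 3)
    (h0 : Module.finrank k (quotPart (perp g) 0) ≠ 0) : perp g ≤ idealOfVars (Fin 4) k := by
  intro f hf
  rw [← constantCoeff_eq_zero_iff_mem_idealOfVars]
  by_contra hne
  have h1 : formProj 4 k 0 f ∈ perp g :=
    formProj_mem_perp (mem_formPart_natCast.2 hg) 0 f hf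
  have h2 : formProj 4 k 0 f = C (constantCoeff f) := by
    rw [eq_C_of_mem_formPart_zero (formProj_mem 0 f), constantCoeff_eq, coeff_formProj]
    simp
  rw [h2] at h1
  have h3 : perp g = ⊤ := Ideal.eq_top_of_isUnit_mem _ h1 ((isUnit_iff_ne_zero.2 hne).map C)
  refine h0 ?_
  have h4 : quotPart (perp g) 0 = ⊥ := by
    refine (Submodule.eq_bot_iff _).2 ?_
    rintro _ ⟨f, _, rfl⟩
    exact Ideal.Quotient.eq_zero_iff_mem.2 (by rw [h3]; exact Submodule.mem_top)
  rw [h4, finrank_bot]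

end Cubic

end Apolarity

end

theorem lemma5p5 {k : Type*} [Field k] [IsAlgClosed k] [CharZero k]
    (g : MvPolynomial (Fin 4) k) (hg : g.IsHomogeneous 3)
    (hA : ∀ i : ℕ, Apolarity.hilbertFunction (Apolarity.perp g) i = [1, 4, 4, 1].getD i 0) :
    (∃ β : ℕ,
      (∃ F : Apolarity.GradedFreeResolution (Apolarity.perp g), F.IsMinimal ∧ F.HasShape β) ∧
      (∀ F : Apolarity.GradedFreeResolution (Apolarity.perp g), F.IsMinimal → F.HasShape β)) ∧
    (∀ d : ℕ, 4 ≤ d → ∀ f ∈ Apolarity.perp g, f.IsHomogeneous d →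
      f ∈ MvPolynomial.idealOfVars (Fin 4) k * Apolarity.perp g) := by
  obtain ⟨β, hβ⟩ := Apolarity.koszulBetti_perp hg hA
  have hshape := Apolarity.hasShape_of_isMinimal hg hβ
  obtain ⟨F, hF⟩ := Apolarity.exists_isMinimal (Apolarity.perp g)
    (fun m f hf => Apolarity.formProj_mem_perp (Apolarity.mem_formPart_natCast.2 hg) m f hf)
    (Apolarity.perp_le_idealOfVars hg (by
      rw [Apolarity.finrank_quotPart_perp hA]
      exact one_ne_zero))
  refine ⟨⟨β, ⟨F, hF, hshape F hF⟩, hshape⟩, fun d hd f hf hfd => ?_⟩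
  refine Apolarity.mem_idealOfVars_mul_of_koszulBetti_eq_zero (d := d) (by omega) ?_ hf
    (Apolarity.mem_formPart_natCast.2 hfd)
  rw [(hβ d).2.1, if_neg (by omega), if_neg (by omega)]
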